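/- **Theorem (overall performance guarantee with finite samples in a DAG).** *Setting.* Let $d\ge 2$ and let $\mathcal D$ be a distribution of pairs $(x,y)\in\mathbb R^d\times\mathbb R$ such that almost surely $\|x\|_\infty\le X_{\max}$, $|y|\le Y_{\max}$ and $\|x\|_2\le R_X$, with $\mathbb E[x_l^2]\le M_X^2$ for all $l$ and $\lambda_{\min}(\Sigma)>0$, where $\Sigma=\mathbb E[xx^T]$. Write $\mathrm{MSE}(f)=\mathbb E[(f(x)-y)^2]$, let $\hat y_0=0$ be the zero predictor, so $\mathrm{MSE}(\hat y_0)=\mathbb E[y^2]$, and let $g^*(x)=(\beta^*)^Tx$ be a linear predictor of smallest MSE among those with $\|\beta\|_1\le A_{g^*}$. The agents are the vertices of a finite directed acyclic graph. Agent $i$ observes a random feature set $S_i\subseteq[d]$, with $\mathbb P[k\in S_i]=p\in(0,1)$ independently over all agents $i$ and features $k$. All agents train on the same dataset $D_m=\{(x^{(j)},y^{(j)})\}_{j\le m}$ of $m$ i.i.d. samples from $\mathcal D$ (no independence between $D_m$ and the sets $S_i$ is needed): the predictor $\hat y_i^{emp}$ is a linear function $w_i^Tx_{S_i}+\sum_{j\in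 \mathrm{Pa}(i)}v_{ij}\hat y_j^{emp}$ of the agent's features and its parents' predictions that minimizes $\frac1m\sum_{j}(f(x^{(j)})-y^{(j)})^2$ over all such functions (ties broken arbitrarily). Let $\eta>0$ and $\delta_L,\delta_m\in(0,1)$. Call a positive integer $N_0$ an *admissible path length* if, for some positive integer $M$, $$N_0\ge\left\lceil\frac{8M^2\,\mathrm{MSE}(\hat y_0)(A_{g^*}M_X)^2}{\eta^2}\right\rceil,\qquad M\ge\left\lceil\frac{\ln(N_0d/M)+\ln(1/\delta_L)}{-\ln(1-p)}\right\rceil .$$ Put $\Lambda_1=\sqrt{2d}\,Y_{\max}/\sqrt{\lambda_{\min}(\Sigma)}$ and $$\epsilon_{gen}=8(\Lambda_1X_{\max}+Y_{\max})\,\Lambda_1X_{\max}\sqrt{\frac{\log d}{m}}+(\Lambda_1X_{\max}+Y_{\max})^2\sqrt{\frac{\log(2/\delta_m)}{2m}} .$$ *Claim.* 1. An admissible path length $N_0$ exists. For $\eta\le1$ it can be chosen with $N_0\le K\,\dfrac{(\log d+\log(1/(p\eta)))^2}{p^2\eta^2}$, where $K$ depends only on $\delta_L$ and on an upper bound for $\mathrm{MSE}(\hat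 y_0)(A_{g^*}M_X)^2$. 2. Suppose $m>4C^2R_X^4(\log d+\log(1/\delta_m))/\lambda_{\min}(\Sigma)^2$ with $C=4$. Then for every admissible $N_0$ and every path $P$ of the DAG with at least $N_0$ agents, with probability at least $1-\delta_L-2\delta_m$ there is an agent on $P$ with index $j^*\le N_0$ along $P$ such that every agent $A_k$ on $P$ from $j^*$ on satisfies $$\mathrm{MSE}(\hat y_k^{emp})\le \mathrm{MSE}(g^*)+\eta+2\,\epsilon_{gen}.$$ 3. For such $m$, the generalization error has the order $$\epsilon_{gen}\le 16\,(\Lambda_1X_{\max}+Y_{\max})\sqrt{1+\log(1/\delta_m)}\cdot\frac{\sqrt d\,X_{\max}Y_{\max}}{\sqrt{\lambda_{\min}(\Sigma)}}\sqrt{\frac{\log d}{m}},$$ that is, $O\!\left(\frac{\sqrt d X_{\max}Y_{\max}}{\sqrt{\lambda_{\min}(\Sigma)}}\sqrt{\frac{\log d}{m}}\right)$ with a factor depending only on $\Lambda_1X_{\max}+Y_{\max}$ and $\delta_m$. -/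

import Mathlib

open MeasureTheory ProbabilityTheory

noncomputable section

namespace DagLearning

/-! ## Risks -/

/-- The true mean squared error of a predictor `f` under the law `D` of a labelled point `(x, y)`. -/
def mse {d : ℕ} (D : Measure ((Fin d → ℝ) × ℝ)) (f : (Fin d → ℝ) → ℝ) : ℝ :=
  ∫ z, (f z.1 - z.2) ^ 2 ∂D

/-- The empirical mean squared error of `f` on the dataset `z`. -/
def empMSE {d m : ℕ} (z : Fin m → (Fin d → ℝ) × ℝ) (f : (Fin d → ℝ) → ℝ) : ℝ :=
  (∑ j, (f (z j).1 - (z j).2) ^ 2) / m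

/-- The linear predictor `x ↦ βᵀ x`. -/
def linPred {d : ℕ} (β : Fin d → ℝ) : (Fin d → ℝ) → ℝ := fun x => ∑ k, β k * x k

/-- `β` is the coefficient vector of an optimal linear predictor among those whose coefficient
vector has `L¹` norm at most `A`. -/
def IsOptimalLinear {d : ℕ} (D : Measure ((Fin d → ℝ) × ℝ)) (A : ℝ) (β : Fin d → ℝ) : Prop :=
  ∑ k, |β k| ≤ A ∧
    ∀ γ : Fin d → ℝ, ∑ k, |γ k| ≤ A → mse D (linPred β) ≤ mse D (linPred γ)

/-! ## Second moment matrix -/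

/-- The matrix `Σ = 𝔼[x xᵀ]`. -/
def covMatrix {d : ℕ} (D : Measure ((Fin d → ℝ) × ℝ)) : Matrix (Fin d) (Fin d) ℝ :=
  Matrix.of fun k l => ∫ z, z.1 k * z.1 l ∂D

theorem covMatrix_isHermitian {d : ℕ} (D : Measure ((Fin d → ℝ) × ℝ)) :
    (covMatrix D).IsHermitian := by
  ext k l
  simp [covMatrix, mul_comm]

/-- The smallest eigenvalue of `Σ = 𝔼[x xᵀ]`. -/
def lambdaMin {d : ℕ} (D : Measure ((Fin d → ℝ) × ℝ)) : ℝ :=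
  ⨅ k, (covMatrix_isHermitian D).eigenvalues k

/-! ## Learning in a DAG -/

/-- The directed graph `G` has no directed cycle. -/
def IsDAG {V : Type*} (G : Digraph V) : Prop := ∀ v, ¬ Relation.TransGen G.Adj v v

/-- `P` is a directed path of `G` with `L` agents. -/
def IsPath {V : Type*} (G : Digraph V) {L : ℕ} (P : Fin L → V) : Prop :=
  ∀ i j : Fin L, (j : ℕ) = i + 1 → G.Adj (P i) (P j)

/-- The models available to agent `i` when the agents predict by `f`: linear functions of its own
features `x k`, `k ∈ S i`, and of the predictions of its parents. -/
def agentModels {V : Type*} [Fintype V] {d : ℕ} (G : Digraph V) (S : V → Set (Fin d))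
    (f : V → (Fin d → ℝ) → ℝ) (i : V) : Set ((Fin d → ℝ) → ℝ) :=
  {h | ∃ (w : Fin d → ℝ) (v : V → ℝ), (∀ k, k ∉ S i → w k = 0) ∧ (∀ j, ¬ G.Adj j i → v j = 0) ∧
    ∀ x, h x = ∑ k, w k * x k + ∑ j, v j * f j x}

/-- `f` is an outcome of the learning process on the DAG for the given loss: each agent uses one of
its available models, and no available model has a smaller loss. -/
def IsLeastSquaresFit {V : Type*} [Fintype V] {d : ℕ} (loss : ((Fin d → ℝ) → ℝ) → ℝ)
    (G : Digraph V) (S : V → Set (Fin d)) (f : V → (Fin d → ℝ) → ℝ) : Prop :=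
  ∀ i, f i ∈ agentModels G S f i ∧ ∀ h ∈ agentModels G S f i, loss (f i) ≤ loss h

/-! ## Randomness -/

/-- Every agent observes every feature with probability `p`, independently over all agents and
features. -/
structure IsRandomAllocation {V Ω : Type*} [MeasurableSpace Ω] (μ : Measure Ω) {d : ℕ}
    (S : V → Ω → Set (Fin d)) (p : ℝ) : Prop where
  measurable : ∀ i k, MeasurableSet {ω | k ∈ S i ω}
  prob : ∀ i k, μ.real {ω | k ∈ S i ω} = p
  indep : iIndepSet (fun q : V × Fin d => {ω | q.2 ∈ S q.1 ω}) μ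

/-- `Z` consists of `m` independent points with law `D`. -/
structure IsIIDSample {Ω : Type*} [MeasurableSpace Ω] (μ : Measure Ω) {d m : ℕ}
    (Z : Fin m → Ω → (Fin d → ℝ) × ℝ) (D : Measure ((Fin d → ℝ) × ℝ)) : Prop where
  measurable : ∀ j, Measurable (Z j)
  law : ∀ j, μ.map (Z j) = D
  indep : iIndepFun Z μ

/-! ## The quantities in the bound -/

/-- `N₀` is an admissible path length, with block length `M`. Here `mse0` is the error of the
initial predictor, `A` the bound on the `L¹` norm of the benchmark and `MX ^ 2` the bound on the
second moments of the features. -/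
structure IsRequiredLength (d : ℕ) (p δL η mse0 A MX : ℝ) (N₀ M : ℕ) : Prop where
  one_le_length : 1 ≤ N₀
  one_le_block : 1 ≤ M
  block : ⌈(Real.log (N₀ * d / M) + Real.log (1 / δL)) / (-Real.log (1 - p))⌉₊ ≤ M
  length : ⌈8 * (M : ℝ) ^ 2 * mse0 * (A * MX) ^ 2 / η ^ 2⌉₊ ≤ N₀

/-- The `L¹` bound `Λ₁ = √(2 d) Y / √λ` on the learned coefficients. -/
def coeffBound (d : ℕ) (Y lam : ℝ) : ℝ := √(2 * d) * Y / √lam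

/-- The generalization error
`8 (Λ₁ X + Y) Λ₁ X √(log d / m) + (Λ₁ X + Y)² √(log (2 / δ) / (2 m))`. -/
def epsGen (d m : ℕ) (X Y lam δ : ℝ) : ℝ :=
  8 * (coeffBound d Y lam * X + Y) * (coeffBound d Y lam * X) * √(Real.log d / m)
    + (coeffBound d Y lam * X + Y) ^ 2 * √(Real.log (2 / δ) / (2 * m))

end DagLearning

end

/-! On a fixed dataset the theorem is Euclidean geometry. An agent projects the label vector onto a
space containing its features and its parents' predictions, so its residual is orthogonal to all of
these and to its own prediction. Along an edge of the path the squared empirical error therefore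
drops by exactly the squared distance of the two predictions. Cut the first `N₀` agents into `N₀ /
M` blocks of `M`. The drops sum to at most the error of the zero predictor, so some block drops
little, and by Cauchy–Schwarz all predictions in it are close to its last one. If the block observes
every feature, the last residual is almost orthogonal to every feature, hence to the benchmark, and
its error almost matches the benchmark's (`norm_sub_sq_le_of_chain_of_features`,
`IsLeastSquaresFit.exists_empMSE_le`). Later agents do no worse, since copying a parent is allowed.

Two random events are needed, and a union bound combines them, so no independence between them
matters. Coverage: a block misses a given feature with probability `(1 - p) ^ M`, and the condition
on `M` makes the sum over blocks and features at most `δL`. Data: learned coefficients depend on the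
sample, so the risk must be controlled uniformly on a fixed `L¹` ball. The risk is quadratic in the
coefficients, with finitely many moments of the law as its coefficients; a maximal inequality for
their deviations bounds the expected supremum, and McDiarmid's inequality its fluctuation
(`IsBoundedLaw.measureReal_supGap_gt_le`). Learned coefficients lie in the ball because projection
does not lengthen the label vector, while concentration in Frobenius norm keeps the empirical second
moment matrix above `λ / 2` (`sum_abs_le_of_norm_predVec_le`).

Two degenerate cases are separate. If `N₀ < M ^ 2`, admissibility forces the benchmark to gain at
most `η` over the zero predictor. If the empirical error of the zero predictor is more than `4 / 3`
of its true error, then both are of the order of the sampling error. -/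

namespace DagLearning

/-! ### Concentration from bounded differences -/

/-- **McDiarmid's inequality**: a function of independent variables with bounded differences is
sub-Gaussian. -/
theorem hasSubgaussianMGF_pi_of_bounded_diff {𝒵 : Type*} [MeasurableSpace 𝒵] (D : Measure 𝒵)
    [IsProbabilityMeasure D] (c : NNReal) (m : ℕ) (F : (Fin m → 𝒵) → ℝ) (hF : Measurable F)
    (C : ℝ) (hC : ∀ z, |F z| ≤ C)
    (hd : ∀ z i a, |F (Function.update z i a) - F z| ≤ c) :
    HasSubgaussianMGF (fun z => F z - ∫ z', F z' ∂(Measure.pi fun _ => D)) (m * (c / 2) ^ 2)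
      (Measure.pi fun _ => D) := by
  induction m with
  | zero =>
    have h0 : ∀ z, F z - ∫ z', F z' ∂(Measure.pi fun _ : Fin 0 => D) = 0 := by
      intro z
      have : F = fun _ => F z := by
        ext w; congr 1; exact Subsingleton.elim _ _
      rw [this]; simp
    simp_rw [h0]
    simp
  | succ m ih =>
    set π := Measure.pi fun _ : Fin m => D
    set μ := Measure.pi fun _ : Fin (m + 1) => D
    have hmp := (measurePreserving_piFinSuccAbove (fun _ : Fin (m + 1) => D) 0).symm
    have hcons : ∀ a w, (MeasurableEquiv.piFinSuccAbove (fun _ : Fin (m + 1) => 𝒵) 0).symm (a, w)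
        = (Fin.cons a w : Fin (m + 1) → 𝒵) := by
      intro a w
      ext i
      simp [MeasurableEquiv.piFinSuccAbove, Fin.insertNthEquiv]
    set F2 : 𝒵 × (Fin m → 𝒵) → ℝ := fun q => F (Fin.cons q.1 q.2) with hF2
    have hF2e : F2 = fun q => F ((MeasurableEquiv.piFinSuccAbove (fun _ => 𝒵) 0).symm q) := by
      ext q; rw [hF2]; dsimp only; rw [← hcons]
    have hF2m : Measurable F2 := by
      rw [hF2e]; exact hF.comp (MeasurableEquiv.measurable _)
    have hchange : ∀ g : ℝ → ℝ, ∫ z, g (F z) ∂μ = ∫ q, g (F2 q) ∂(D.prod π) := by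
      intro g
      rw [hF2e]
      exact (hmp.integral_comp' (fun z => g (F z))).symm
    have hbdd2 : ∀ q, |F2 q| ≤ C := fun q => hC _
    have hint2 : Integrable F2 (D.prod π) :=
      Integrable.of_bound hF2m.aestronglyMeasurable C (ae_of_all _ fun q => by
        simpa using hbdd2 q)
    -- `G` is the conditional mean of `F` given the first coordinate. It oscillates by at most `c`,
    -- so Hoeffding's lemma contributes `(c / 2) ^ 2`; the fluctuation around `G` in the other
    -- coordinates is the induction hypothesis, and the two exponential moments multiply.
    set G : 𝒵 → ℝ := fun a => ∫ w, F2 (a, w) ∂π with hG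
    have hGm : Measurable G := (hF2m.stronglyMeasurable.integral_prod_right').measurable
    have hintw : ∀ a, Integrable (fun w => F2 (a, w)) π := fun a =>
      Integrable.of_bound (hF2m.comp measurable_prodMk_left).aestronglyMeasurable C
        (ae_of_all _ fun w => by simpa using hbdd2 (a, w))
    have hEF : ∫ z, F z ∂μ = ∫ a, G a ∂D := by
      have := hchange id
      simp only [id] at this
      rw [this, integral_prod _ hint2]
    have hGd : ∀ a b, G a ≤ G b + c := by
      intro a b
      have : G b + c = ∫ w, (F2 (b, w) + c) ∂π := by
        rw [integral_add (hintw b) (integrable_const _)]; simp [hG]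
      rw [this]
      refine integral_mono (hintw a) ((hintw b).add (integrable_const _)) fun w => ?_
      have := hd (Fin.cons b w) 0 a
      rw [Fin.update_cons_zero] at this
      have := (abs_le.1 this).2
      simp only [hF2]; linarith
    have hGb : ∀ a, |G a| ≤ C := by
      intro a
      have := norm_integral_le_of_norm_le_const (μ := π) (f := fun w => F2 (a, w)) (C := C)
        (ae_of_all _ fun w => by simpa using hbdd2 (a, w))
      simpa using this
    have : Nonempty 𝒵 := nonempty_of_isProbabilityMeasure D
    have hbelow : BddBelow (Set.range G) :=
      ⟨-C, by rintro _ ⟨a, rfl⟩; exact (abs_le.1 (hGb a)).1⟩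
    have hGs : HasSubgaussianMGF (fun a => G a - ∫ a, G a ∂D) ((c / 2) ^ 2) D := by
      have := hasSubgaussianMGF_of_mem_Icc (μ := D) (X := G) (a := ⨅ a, G a)
        (b := (⨅ a, G a) + c) hGm.aemeasurable
        (ae_of_all _ fun a => ⟨ciInf_le hbelow a, by
          have : G a - c ≤ ⨅ b, G b := le_ciInf fun b => by linarith [hGd a b]
          linarith⟩)
      simpa using this
    have hin : ∀ a, HasSubgaussianMGF (fun w => F2 (a, w) - G a) (m * (c / 2) ^ 2) π := by
      intro a
      refine ih (fun w => F2 (a, w)) (hF2m.comp measurable_prodMk_left)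
        (fun w => hbdd2 (a, w)) ?_
      intro w i b
      have := hd (Fin.cons a w) i.succ b
      rwa [← Fin.cons_update] at this
    have hexpb : ∀ t x : ℝ, |x| ≤ C → |Real.exp (t * (x - ∫ z, F z ∂μ))|
        ≤ Real.exp (|t| * (C + |∫ z, F z ∂μ|)) := by
      intro t x hx
      rw [abs_of_pos (Real.exp_pos _)]
      apply Real.exp_le_exp.2
      calc t * (x - ∫ z, F z ∂μ) ≤ |t * (x - ∫ z, F z ∂μ)| := le_abs_self _
        _ = |t| * |x - ∫ z, F z ∂μ| := abs_mul _ _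
        _ ≤ |t| * (C + |∫ z, F z ∂μ|) := by
          gcongr
          exact (abs_sub _ _).trans (by gcongr)
    refine ⟨fun t => ?_, fun t => ?_⟩
    · exact Integrable.of_bound (by fun_prop) _ (ae_of_all _ fun z => hexpb t (F z) (hC z))
    · have h1 : mgf (fun z => F z - ∫ z', F z' ∂μ) μ t
          = ∫ a, ∫ w, Real.exp (t * (F2 (a, w) - ∫ z, F z ∂μ)) ∂π ∂D := by
        unfold mgf
        rw [hchange fun x => Real.exp (t * (x - ∫ z, F z ∂μ)), integral_prod]
        exact Integrable.of_bound (by fun_prop) _ (ae_of_all _ fun z => hexpb t (F2 z) (hbdd2 z))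
      have h2 : ∀ a, ∫ w, Real.exp (t * (F2 (a, w) - ∫ z, F z ∂μ)) ∂π
          ≤ Real.exp ((m * (c / 2) ^ 2 : NNReal) * t ^ 2 / 2)
            * Real.exp (t * (G a - ∫ a, G a ∂D)) := by
        intro a
        have e : ∀ w, Real.exp (t * (F2 (a, w) - ∫ z, F z ∂μ))
            = Real.exp (t * (F2 (a, w) - G a)) * Real.exp (t * (G a - ∫ a, G a ∂D)) := by
          intro w
          rw [← Real.exp_add, hEF]; congr 1; ring
        simp_rw [e]
        rw [integral_mul_const]
        gcongr
        exact (hin a).mgf_le t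
      rw [h1]
      calc _ ≤ ∫ a, Real.exp ((m * (c / 2) ^ 2 : NNReal) * t ^ 2 / 2)
            * Real.exp (t * (G a - ∫ a, G a ∂D)) ∂D := by
            refine integral_mono_of_nonneg (ae_of_all _ fun a => ?_)
              ((hGs.integrable_exp_mul t).const_mul _) (ae_of_all _ h2)
            exact integral_nonneg fun w => (Real.exp_pos _).le
        _ ≤ Real.exp ((m * (c / 2) ^ 2 : NNReal) * t ^ 2 / 2)
            * Real.exp (((c / 2) ^ 2 : NNReal) * t ^ 2 / 2) := by
            rw [integral_const_mul]
            gcongr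
            exact hGs.mgf_le t
        _ = _ := by
            rw [← Real.exp_add]; congr 1; push_cast; ring

/-- McDiarmid's inequality when the differences are bounded on a set of full measure. -/
theorem hasSubgaussianMGF_pi_of_bounded_diff_on {𝒵 : Type*} [MeasurableSpace 𝒵] (D : Measure 𝒵)
    [IsProbabilityMeasure D] {B : Set 𝒵} (hB : MeasurableSet B) (hDB : ∀ᵐ x ∂D, x ∈ B)
    {c : NNReal} {m : ℕ} {F : (Fin m → 𝒵) → ℝ} (hF : Measurable F)
    {C : ℝ} (hC : ∀ z, (∀ j, z j ∈ B) → |F z| ≤ C)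
    (hd : ∀ z i, ∀ a ∈ B, (∀ j, z j ∈ B) → |F (Function.update z i a) - F z| ≤ c) :
    HasSubgaussianMGF (fun z => F z - ∫ z', F z' ∂(Measure.pi fun _ => D)) (m * (c / 2) ^ 2)
      (Measure.pi fun _ => D) := by
  classical
  obtain ⟨b, hb⟩ := hDB.exists
  -- Moving points outside `B` to a fixed point of `B` changes `F` only on a null set and makes its
  -- bounds hold everywhere.
  set r : 𝒵 → 𝒵 := fun x => if x ∈ B then x else b
  have hr : ∀ x, r x ∈ B := fun x => by dsimp only [r]; split_ifs <;> assumption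
  have hrm : Measurable r := Measurable.ite hB measurable_id measurable_const
  have hae : ∀ᵐ z ∂(Measure.pi fun _ : Fin m => D), (fun j => r (z j)) = z := by
    have : ∀ᵐ z ∂(Measure.pi fun _ : Fin m => D), ∀ j, z j ∈ B :=
      ae_all_iff.2 fun j =>
        (measurePreserving_eval (fun _ : Fin m => D) j).quasiMeasurePreserving.ae hDB
    filter_upwards [this] with z hz
    ext j
    simp [r, hz j]
  have h := hasSubgaussianMGF_pi_of_bounded_diff D c m (fun z => F fun j => r (z j))
    (hF.comp (measurable_pi_lambda _ fun j => hrm.comp (measurable_pi_apply j))) C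
    (fun z => hC _ fun j => hr _) (by
      intro z i a
      have := hd (fun j => r (z j)) i (r a) (hr a) (fun j => hr _)
      convert this using 4
      ext j
      by_cases hj : j = i
      · subst hj; simp
      · simp [hj])
  have hi : ∫ z, F (fun j => r (z j)) ∂(Measure.pi fun _ : Fin m => D)
      = ∫ z, F z ∂(Measure.pi fun _ : Fin m => D) :=
    integral_congr_ae (by filter_upwards [hae] with z hz; rw [hz])
  rw [hi] at h
  exact h.congr (by filter_upwards [hae] with z hz; rw [hz])

/-- The upper tail of a function with bounded differences `c / m`. -/
theorem measureReal_add_sqrt_lt_le {𝒵 : Type*} [MeasurableSpace 𝒵] (D : Measure 𝒵)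
    [IsProbabilityMeasure D] {B : Set 𝒵} (hB : MeasurableSet B) (hDB : ∀ᵐ x ∂D, x ∈ B)
    {c : ℝ} (hc : 0 ≤ c) {m : ℕ} (hm : 0 < m) {F : (Fin m → 𝒵) → ℝ} (hF : Measurable F)
    {C : ℝ} (hC : ∀ z, (∀ j, z j ∈ B) → |F z| ≤ C)
    (hd : ∀ z i, ∀ a ∈ B, (∀ j, z j ∈ B) → |F (Function.update z i a) - F z| ≤ c / m)
    {δ : ℝ} (hδ : δ ∈ Set.Ioo (0 : ℝ) 1) {s : ℝ}
    (hs : ∫ z, F z ∂(Measure.pi fun _ => D) + c * √(Real.log (1 / δ) / (2 * m)) ≤ s) :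
    (Measure.pi fun _ => D).real {z : Fin m → 𝒵 | s < F z} ≤ δ := by
  have hl : 0 < Real.log (1 / δ) := Real.log_pos (by rw [lt_div_iff₀ hδ.1]; linarith [hδ.2])
  have hm' : (0 : ℝ) < m := by exact_mod_cast hm
  have hcm : ((c / m).toNNReal : ℝ) = c / m := Real.coe_toNNReal _ (by positivity)
  have h := hasSubgaussianMGF_pi_of_bounded_diff_on D hB hDB (c := (c / m).toNNReal) hF hC
    (by rwa [hcm])
  -- For `c = 0` the tail bound has exponent `0 / 0 = 0` and says nothing; instead a zero variance
  -- proxy makes `F` almost surely equal to its mean.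
  rcases hc.eq_or_lt with rfl | hc
  · have h0 : (m : NNReal) * ((0 / (m : ℝ)).toNNReal / 2) ^ 2 = 0 := by simp
    rw [h0] at h
    have h1 : (Measure.pi fun _ => D) {z | s < F z} = 0 := by
      rw [← compl_mem_ae_iff]
      filter_upwards [h.ae_eq_zero_of_hasSubgaussianMGF_zero] with z hz
      simp only [Pi.zero_apply] at hz
      simp only [Set.mem_compl_iff, Set.mem_ofPred_eq, not_lt]
      linarith
    rw [measureReal_def, h1]
    simpa using hδ.1.le
  · have h1 := h.measure_ge_le (ε := c * √(Real.log (1 / δ) / (2 * m))) (by positivity)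
    refine (measureReal_mono ?_).trans (h1.trans ?_)
    · intro z hz
      simp only [Set.mem_ofPred_eq] at hz ⊢
      linarith
    have e : -(c * √(Real.log (1 / δ) / (2 * m))) ^ 2 /
        (2 * ((m * ((c / m).toNNReal / 2) ^ 2 : NNReal) : ℝ)) = Real.log δ := by
      rw [mul_pow, Real.sq_sqrt (by positivity)]
      push_cast
      rw [one_div, Real.log_inv, hcm]
      field_simp
    rw [e, Real.exp_log hδ.1]

/-! ### Deviations of sample means -/

/-- The sample mean of `φ`. -/
noncomputable def avg {𝒵 : Type*} {m : ℕ} (φ : 𝒵 → ℝ) (z : Fin m → 𝒵) : ℝ := (∑ j, φ (z j)) / m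

/-- The difference of the mean and the sample mean of `φ`. -/
noncomputable def dev {𝒵 : Type*} [MeasurableSpace 𝒵] {m : ℕ} (D : Measure 𝒵) (φ : 𝒵 → ℝ)
    (z : Fin m → 𝒵) : ℝ := ∫ x, φ x ∂D - avg φ z

theorem ae_pi_mem {𝒵 : Type*} [MeasurableSpace 𝒵] {D : Measure 𝒵} [IsProbabilityMeasure D]
    {B : Set 𝒵} (hDB : ∀ᵐ x ∂D, x ∈ B) (m : ℕ) :
    ∀ᵐ z ∂(Measure.pi fun _ : Fin m => D), ∀ j, z j ∈ B :=
  ae_all_iff.2 fun j =>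
    (measurePreserving_eval (fun _ : Fin m => D) j).quasiMeasurePreserving.ae hDB

theorem measurable_avg {𝒵 : Type*} [MeasurableSpace 𝒵] {m : ℕ} {φ : 𝒵 → ℝ} (hφ : Measurable φ) :
    Measurable (avg φ : (Fin m → 𝒵) → ℝ) := by
  unfold avg
  exact (Finset.measurable_sum _ fun j _ => hφ.comp (measurable_pi_apply j)).div_const _

theorem measurable_dev {𝒵 : Type*} [MeasurableSpace 𝒵] {m : ℕ} {D : Measure 𝒵} {φ : 𝒵 → ℝ}
    (hφ : Measurable φ) : Measurable (dev D φ : (Fin m → 𝒵) → ℝ) :=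
  measurable_const.sub (measurable_avg hφ)

theorem avg_update_sub {𝒵 : Type*} {m : ℕ} (φ : 𝒵 → ℝ) (z : Fin m → 𝒵) (i : Fin m) (a : 𝒵) :
    avg φ (Function.update z i a) - avg φ z = (φ a - φ (z i)) / m := by
  unfold avg
  rw [← sub_div, ← Finset.sum_sub_distrib, Finset.sum_eq_single i]
  · simp
  · intro j _ hj; simp [hj]
  · simp

theorem integrable_of_abs_le_on {𝒵 : Type*} [MeasurableSpace 𝒵] {D : Measure 𝒵}
    [IsProbabilityMeasure D] {B : Set 𝒵} (hDB : ∀ᵐ x ∂D, x ∈ B) {φ : 𝒵 → ℝ} (hφ : Measurable φ)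
    {R : ℝ} (hR : ∀ x ∈ B, |φ x| ≤ R) : Integrable φ D :=
  Integrable.of_bound hφ.aestronglyMeasurable R (hDB.mono fun x hx => hR x hx)

theorem abs_integral_le_of_abs_le_on {𝒵 : Type*} [MeasurableSpace 𝒵] {D : Measure 𝒵}
    [IsProbabilityMeasure D] {B : Set 𝒵} (hDB : ∀ᵐ x ∂D, x ∈ B) {φ : 𝒵 → ℝ}
    {R : ℝ} (hR : ∀ x ∈ B, |φ x| ≤ R) : |∫ x, φ x ∂D| ≤ R := by
  have := norm_integral_le_of_norm_le_const (μ := D) (f := φ) (C := R)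
    (hDB.mono fun x hx => hR x hx)
  simpa using this

theorem abs_avg_le {𝒵 : Type*} {m : ℕ} (hm : 0 < m) {B : Set 𝒵} {φ : 𝒵 → ℝ}
    {R : ℝ} (hR : ∀ x ∈ B, |φ x| ≤ R) {z : Fin m → 𝒵} (hz : ∀ j, z j ∈ B) : |avg φ z| ≤ R := by
  have hm' : (0 : ℝ) < m := by exact_mod_cast hm
  unfold avg
  rw [abs_div, abs_of_pos hm', div_le_iff₀ hm']
  calc |∑ j, φ (z j)| ≤ ∑ j, |φ (z j)| := Finset.abs_sum_le_sum_abs _ _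
    _ ≤ ∑ _j : Fin m, R := Finset.sum_le_sum fun j _ => hR _ (hz j)
    _ = R * m := by simp [mul_comm]

theorem integral_avg {𝒵 : Type*} [MeasurableSpace 𝒵] {D : Measure 𝒵} [IsProbabilityMeasure D]
    {m : ℕ} (hm : 0 < m) {φ : 𝒵 → ℝ} (hφ : Integrable φ D) :
    ∫ z, avg φ z ∂(Measure.pi fun _ : Fin m => D) = ∫ x, φ x ∂D := by
  have hm' : (m : ℝ) ≠ 0 := by exact_mod_cast hm.ne'
  unfold avg
  rw [integral_div, integral_finsetSum]
  · have : ∀ j : Fin m, ∫ z : Fin m → 𝒵, φ (z j) ∂(Measure.pi fun _ : Fin m => D)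
        = ∫ x, φ x ∂D := fun j =>
      integral_comp_eval (μ := fun _ : Fin m => D) hφ.aestronglyMeasurable
    simp_rw [this]
    simp [hm']
  · intro j _
    exact (measurePreserving_eval (fun _ : Fin m => D) j).integrable_comp_of_integrable hφ

theorem integrable_avg {𝒵 : Type*} [MeasurableSpace 𝒵] {D : Measure 𝒵} [IsProbabilityMeasure D]
    {m : ℕ} {φ : 𝒵 → ℝ} (hφ : Integrable φ D) :
    Integrable (avg φ) (Measure.pi fun _ : Fin m => D) := by
  unfold avg
  exact (integrable_finsetSum _ fun j _ =>
    (measurePreserving_eval (fun _ : Fin m => D) j).integrable_comp_of_integrable hφ).div_const _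

theorem integral_dev {𝒵 : Type*} [MeasurableSpace 𝒵] {D : Measure 𝒵} [IsProbabilityMeasure D]
    {m : ℕ} (hm : 0 < m) {φ : 𝒵 → ℝ} (hφ : Integrable φ D) :
    ∫ z, dev D φ z ∂(Measure.pi fun _ : Fin m => D) = 0 := by
  unfold dev
  rw [integral_sub (integrable_const _) (integrable_avg hφ), integral_avg hm hφ]
  simp

theorem integral_dev_sq_le {𝒵 : Type*} [MeasurableSpace 𝒵] {D : Measure 𝒵}
    [IsProbabilityMeasure D] {m : ℕ} (hm : 0 < m) {φ : 𝒵 → ℝ} (hφ : MemLp φ 2 D) :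
    ∫ z, dev D φ z ^ 2 ∂(Measure.pi fun _ : Fin m => D) ≤ (∫ x, φ x ^ 2 ∂D) / m := by
  have hm' : (0 : ℝ) < m := by exact_mod_cast hm
  have hi := hφ.integrable (by norm_num)
  have h1 := variance_sum_pi (μ := fun _ : Fin m => D) (X := fun _ => φ) (fun _ => hφ)
  have hmem : MemLp (∑ i : Fin m, fun ω : Fin m → 𝒵 => φ (ω i)) 2
      (Measure.pi fun _ : Fin m => D) :=
    memLp_finsetSum' _ fun j _ =>
      hφ.comp_measurePreserving (measurePreserving_eval (fun _ : Fin m => D) j)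
  rw [variance_eq_integral hmem.aemeasurable] at h1
  have e : ∀ z : Fin m → 𝒵, dev D φ z ^ 2 = ((∑ i : Fin m, fun ω : Fin m → 𝒵 => φ (ω i)) z
      - ∫ z, (∑ i : Fin m, fun ω : Fin m → 𝒵 => φ (ω i)) z ∂(Measure.pi fun _ : Fin m => D)) ^ 2
      / m ^ 2 := by
    intro z
    have := integral_avg hm hi
    unfold avg at this
    rw [integral_div, div_eq_iff hm'.ne'] at this
    simp only [Finset.sum_apply]
    rw [this, dev, avg]
    field_simp
    ring
  simp_rw [e]
  rw [integral_div, h1]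
  simp only [Finset.sum_const, Finset.card_univ, Fintype.card_fin, nsmul_eq_mul]
  rw [div_le_div_iff₀ (by positivity) hm']
  have : Var[φ; D] ≤ ∫ x, φ x ^ 2 ∂D := variance_le_expectation_sq hφ.aestronglyMeasurable
  nlinarith [mul_le_mul_of_nonneg_left this (by positivity : (0 : ℝ) ≤ m ^ 2)]

/-- Replacing one sample point moves the mean by at most `2 * R / m`, so the bounded difference
proxy is `m * (R / m) ^ 2`. -/
theorem hasSubgaussianMGF_dev {𝒵 : Type*} [MeasurableSpace 𝒵] {D : Measure 𝒵}
    [IsProbabilityMeasure D] {B : Set 𝒵} (hB : MeasurableSet B) (hDB : ∀ᵐ x ∂D, x ∈ B)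
    {m : ℕ} (hm : 0 < m) {φ : 𝒵 → ℝ} (hφ : Measurable φ) {R : NNReal}
    (hR : ∀ x ∈ B, |φ x| ≤ R) :
    HasSubgaussianMGF (dev D φ) (R ^ 2 / m) (Measure.pi fun _ : Fin m => D) := by
  have hm' : (0 : ℝ) < m := by exact_mod_cast hm
  have h := hasSubgaussianMGF_pi_of_bounded_diff_on D hB hDB (c := 2 * R / m) (F := dev D φ)
    (measurable_dev hφ) (C := R + R)
    (fun z hz => by
      unfold dev
      exact (abs_sub _ _).trans
        (add_le_add (abs_integral_le_of_abs_le_on hDB hR) (abs_avg_le hm hR hz)))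
    (fun z i a ha hz => by
      unfold dev
      rw [sub_sub_sub_cancel_left, abs_sub_comm, avg_update_sub, abs_div, abs_of_pos hm']
      push_cast
      gcongr
      exact (abs_sub _ _).trans (by linarith [hR a ha, hR _ (hz i)]))
  rw [integral_dev hm (integrable_of_abs_le_on hDB hφ hR)] at h
  have e : (m : NNReal) * (2 * R / m / 2) ^ 2 = R ^ 2 / m := by
    have : (m : NNReal) ≠ 0 := by exact_mod_cast hm.ne'
    field_simp
  rw [e] at h
  simpa using h

/-- Maximal inequality: finitely many sample means have a common bound for their deviations whose
expectation grows like the square root of the logarithm of their number. -/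
theorem exists_integrable_bound_dev {𝒵 : Type*} [MeasurableSpace 𝒵] {D : Measure 𝒵}
    [IsProbabilityMeasure D] {B : Set 𝒵} (hB : MeasurableSet B) (hDB : ∀ᵐ x ∂D, x ∈ B)
    {m : ℕ} (hm : 0 < m) {ι : Type*} [Fintype ι] [Nonempty ι] {φ : ι → 𝒵 → ℝ}
    (hφ : ∀ i, Measurable (φ i)) {R : ℝ} (hR0 : 0 ≤ R) (hR : ∀ i, ∀ x ∈ B, |φ i x| ≤ R) :
    ∃ H : (Fin m → 𝒵) → ℝ, Integrable H (Measure.pi fun _ : Fin m => D) ∧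
      (∀ z, (∀ j, z j ∈ B) → ∀ i, |dev D (φ i) z| ≤ H z) ∧
      ∫ z, H z ∂(Measure.pi fun _ : Fin m => D)
        ≤ R * √(2 * Real.log (2 * Fintype.card ι) / m) := by
  have hm' : (0 : ℝ) < m := by exact_mod_cast hm
  rcases hR0.eq_or_lt with rfl | hRp
  · refine ⟨fun _ => 0, integrable_const _, fun z hz i => ?_, by simp⟩
    have h1 := abs_integral_le_of_abs_le_on hDB (hR i)
    have h2 := abs_avg_le hm (hR i) hz
    unfold dev
    exact (abs_sub _ _).trans (by linarith)
  set N : ℝ := (Fintype.card ι : ℝ) with hNdef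
  have hN : 1 ≤ N := by
    have : 0 < Fintype.card ι := Fintype.card_pos
    simp only [N]; exact_mod_cast this
  have hlog : 0 < Real.log (2 * N) := Real.log_pos (by linarith)
  lift R to NNReal using hR0
  have hsub := fun i => hasSubgaussianMGF_dev hB hDB hm (hφ i) (hR i)
  -- `s` makes every exponential moment of `± s * dev` at most `2 * N`. There are `2 * N` signed
  -- deviations, so their sum has mean at most `K = (2 * N) ^ 2`.
  set s : ℝ := √(2 * Real.log (2 * N) * m) / R with hs
  have hspos : 0 < s := by positivity
  have hs2 : s ^ 2 * R ^ 2 = 2 * Real.log (2 * N) * m := by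
    rw [hs, div_pow, Real.sq_sqrt (by positivity)]; field_simp
  set K : ℝ := (2 * N) * (2 * N) with hK
  have hKpos : 0 < K := by positivity
  refine ⟨fun z => (Real.log K - 1 + (∑ i, (Real.exp (s * dev D (φ i) z)
    + Real.exp (-s * dev D (φ i) z))) / K) / s, ?_, ?_, ?_⟩
  · exact ((integrable_const _).add ((integrable_finsetSum _ fun i _ =>
      ((hsub i).integrable_exp_mul s).add ((hsub i).integrable_exp_mul (-s))).div_const _)).div_const _
  · intro z _ i
    -- The tangent of the logarithm at `K` bounds `t = log (exp t)`. Hence `H` is affine in the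
    -- exponentials and its expectation needs only linearity.
    have key : ∀ t : ℝ, t ≤ Real.log K - 1 + Real.exp t / K := by
      intro t
      have := Real.add_one_le_exp (t - Real.log K)
      rw [Real.exp_sub, Real.exp_log hKpos] at this
      linarith
    have hsum : ∀ i, Real.exp (s * dev D (φ i) z) + Real.exp (-s * dev D (φ i) z)
        ≤ ∑ i, (Real.exp (s * dev D (φ i) z) + Real.exp (-s * dev D (φ i) z)) := fun i =>
      Finset.single_le_sum (f := fun i => Real.exp (s * dev D (φ i) z)
        + Real.exp (-s * dev D (φ i) z)) (fun i _ => by positivity) (Finset.mem_univ i)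
    rw [le_div_iff₀ hspos]
    rcases abs_cases (dev D (φ i) z) with ⟨h, _⟩ | ⟨h, _⟩
    · rw [h, mul_comm]
      refine (key _).trans ?_
      gcongr
      exact le_trans (by linarith [Real.exp_pos (-s * dev D (φ i) z)]) (hsum i)
    · rw [h, neg_mul, mul_comm, ← neg_mul]
      refine (key _).trans ?_
      gcongr
      exact le_trans (by linarith [Real.exp_pos (s * dev D (φ i) z)]) (hsum i)
  · have hmgf : ∀ i, ∀ t : ℝ, t ^ 2 = s ^ 2 → ∫ z, Real.exp (t * dev D (φ i) z)
        ∂(Measure.pi fun _ : Fin m => D) ≤ 2 * N := by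
      intro i t ht
      refine ((hsub i).mgf_le t).trans ?_
      have : ((R ^ 2 / m : NNReal) : ℝ) * t ^ 2 / 2 = Real.log (2 * N) := by
        push_cast
        rw [ht]
        field_simp
        linarith
      rw [this, Real.exp_log (by positivity)]
    have hI : ∀ i, Integrable (fun z => Real.exp (s * dev D (φ i) z)
        + Real.exp (-s * dev D (φ i) z)) (Measure.pi fun _ : Fin m => D) := fun i =>
      ((hsub i).integrable_exp_mul s).add ((hsub i).integrable_exp_mul (-s))
    rw [integral_div, integral_add (integrable_const _)
      ((integrable_finsetSum _ fun i _ => hI i).div_const _), integral_div,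
      integral_finsetSum _ fun i _ => hI i]
    have hS : ∑ i, ∫ z, (Real.exp (s * dev D (φ i) z) + Real.exp (-s * dev D (φ i) z))
        ∂(Measure.pi fun _ : Fin m => D) ≤ K := by
      calc _ ≤ ∑ _i : ι, (2 * N + 2 * N) := by
            refine Finset.sum_le_sum fun i _ => ?_
            rw [integral_add ((hsub i).integrable_exp_mul s) ((hsub i).integrable_exp_mul (-s))]
            exact add_le_add (hmgf i s rfl) (hmgf i (-s) (by ring))
        _ = K := by simp [hK, N]; ring
    have hS' := div_le_one_of_le₀ hS hKpos.le
    have hlogK : Real.log K = 2 * Real.log (2 * N) := by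
      rw [hK, Real.log_mul (by positivity) (by positivity)]; ring
    have hfin : (2 * Real.log (2 * N)) / s = R * √(2 * Real.log (2 * N) / m) := by
      rw [div_eq_iff hspos.ne', hs]
      have : √(2 * Real.log (2 * N) / m) * √(2 * Real.log (2 * N) * m) = 2 * Real.log (2 * N) := by
        rw [← Real.sqrt_mul (by positivity)]
        rw [show 2 * Real.log (2 * N) / m * (2 * Real.log (2 * N) * m)
          = (2 * Real.log (2 * N)) ^ 2 by field_simp]
        exact Real.sqrt_sq (by positivity)
      field_simp
      linarith
    rw [← hfin, ← hlogK]
    gcongr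
    simp only [integral_const, probReal_univ, smul_eq_mul, one_mul]
    linarith

/-- Hoeffding's inequality for the sample mean of a nonnegative bounded function. -/
theorem measureReal_avg_gt_le {𝒵 : Type*} [MeasurableSpace 𝒵] {D : Measure 𝒵}
    [IsProbabilityMeasure D] {B : Set 𝒵} (hB : MeasurableSet B) (hDB : ∀ᵐ x ∂D, x ∈ B)
    {m : ℕ} (hm : 0 < m) {φ : 𝒵 → ℝ} (hφ : Measurable φ) {w : ℝ} (hw : 0 ≤ w)
    (hφ0 : ∀ x ∈ B, 0 ≤ φ x) (hφw : ∀ x ∈ B, φ x ≤ w) {δ : ℝ} (hδ : δ ∈ Set.Ioo (0 : ℝ) 1) :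
    (Measure.pi fun _ => D).real
      {z : Fin m → 𝒵 | ∫ x, φ x ∂D + w * √(Real.log (1 / δ) / (2 * m)) < avg φ z} ≤ δ := by
  have hm' : (0 : ℝ) < m := by exact_mod_cast hm
  have habs : ∀ x ∈ B, |φ x| ≤ w := fun x hx => abs_le.2 ⟨by linarith [hφ0 x hx], hφw x hx⟩
  refine measureReal_add_sqrt_lt_le D hB hDB hw hm (measurable_avg hφ)
    (fun z hz => abs_avg_le hm habs hz) (fun z i a ha hz => ?_) hδ ?_
  · rw [avg_update_sub, abs_div, abs_of_pos hm']
    gcongr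
    rw [abs_le]
    constructor <;> linarith [hφ0 a ha, hφw a ha, hφ0 _ (hz i), hφw _ (hz i)]
  · rw [integral_avg hm (integrable_of_abs_le_on hDB hφ habs)]

/-! ### Bounded data and the quadratic form of the risk -/

/-- The labelled points that satisfy the almost sure bounds. -/
def box (d : ℕ) (X Y R : ℝ) : Set ((Fin d → ℝ) × ℝ) :=
  {q | (∀ k, |q.1 k| ≤ X) ∧ |q.2| ≤ Y ∧ ∑ k, q.1 k ^ 2 ≤ R}

theorem measurableSet_box (d : ℕ) (X Y R : ℝ) : MeasurableSet (box d X Y R) := by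
  have h1 : IsClosed {q : (Fin d → ℝ) × ℝ | ∀ k, |q.1 k| ≤ X} := by
    have : {q : (Fin d → ℝ) × ℝ | ∀ k, |q.1 k| ≤ X} = ⋂ k, {q | |q.1 k| ≤ X} := by
      ext; simp
    rw [this]
    exact isClosed_iInter fun k => isClosed_le (by fun_prop) continuous_const
  have h2 : IsClosed {q : (Fin d → ℝ) × ℝ | |q.2| ≤ Y} := isClosed_le (by fun_prop) continuous_const
  have h3 : IsClosed {q : (Fin d → ℝ) × ℝ | ∑ k, q.1 k ^ 2 ≤ R} :=
    isClosed_le (by fun_prop) continuous_const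
  exact (h1.inter (h2.inter h3)).measurableSet

theorem dev_sub {𝒵 : Type*} [MeasurableSpace 𝒵] {D : Measure 𝒵} {m : ℕ} {φ ψ : 𝒵 → ℝ}
    (hφ : Integrable φ D) (hψ : Integrable ψ D) (z : Fin m → 𝒵) :
    dev D (fun q => φ q - ψ q) z = dev D φ z - dev D ψ z := by
  simp only [dev, avg]
  rw [integral_sub hφ hψ, Finset.sum_sub_distrib]
  ring

theorem dev_add {𝒵 : Type*} [MeasurableSpace 𝒵] {D : Measure 𝒵} {m : ℕ} {φ ψ : 𝒵 → ℝ}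
    (hφ : Integrable φ D) (hψ : Integrable ψ D) (z : Fin m → 𝒵) :
    dev D (fun q => φ q + ψ q) z = dev D φ z + dev D ψ z := by
  simp only [dev, avg]
  rw [integral_add hφ hψ, Finset.sum_add_distrib]
  ring

theorem dev_const_mul {𝒵 : Type*} [MeasurableSpace 𝒵] {D : Measure 𝒵} {m : ℕ} (c : ℝ) (φ : 𝒵 → ℝ)
    (z : Fin m → 𝒵) : dev D (fun q => c * φ q) z = c * dev D φ z := by
  simp only [dev, avg]
  rw [integral_const_mul, ← Finset.mul_sum]
  ring

theorem dev_sum {𝒵 : Type*} [MeasurableSpace 𝒵] {D : Measure 𝒵} {m : ℕ} {ι : Type*} [Fintype ι]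
    {φ : ι → 𝒵 → ℝ} (hφ : ∀ i, Integrable (φ i) D) (z : Fin m → 𝒵) :
    dev D (fun q => ∑ i, φ i q) z = ∑ i, dev D (φ i) z := by
  simp only [dev, avg]
  rw [integral_finsetSum _ fun i _ => hφ i, Finset.sum_comm, Finset.sum_sub_distrib,
    Finset.sum_div]

theorem sq_linPred_sub {d : ℕ} (β : Fin d → ℝ) (q : (Fin d → ℝ) × ℝ) :
    (linPred β q.1 - q.2) ^ 2 = ∑ k, ∑ l, β k * β l * (q.1 k * q.1 l)
      - ∑ k, 2 * β k * (q.1 k * q.2) + q.2 ^ 2 := by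
  have h1 : ∑ k, ∑ l, β k * β l * (q.1 k * q.1 l) = linPred β q.1 * linPred β q.1 := by
    simp only [linPred, Finset.sum_mul_sum]
    exact Finset.sum_congr rfl fun k _ => Finset.sum_congr rfl fun l _ => by ring
  have h2 : ∑ k, 2 * β k * (q.1 k * q.2) = 2 * linPred β q.1 * q.2 := by
    simp only [linPred, Finset.mul_sum, Finset.sum_mul]
    exact Finset.sum_congr rfl fun k _ => by ring
  rw [h1, h2]; ring

/-- The bounds on the law of the data. -/
structure IsBoundedLaw {d : ℕ} (D : Measure ((Fin d → ℝ) × ℝ)) (X Y R : ℝ) : Prop where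
  prob : IsProbabilityMeasure D
  ae_mem : ∀ᵐ q ∂D, q ∈ box d X Y R

section
variable {d m : ℕ} {D : Measure ((Fin d → ℝ) × ℝ)} {X Y R : ℝ}

theorem abs_mul_le_of_mem_box {q : (Fin d → ℝ) × ℝ} (hq : q ∈ box d X Y R) (k l : Fin d) :
    |q.1 k * q.1 l| ≤ X ^ 2 := by
  rw [abs_mul, sq]
  exact mul_le_mul (hq.1 k) (hq.1 l) (abs_nonneg _) ((abs_nonneg _).trans (hq.1 k))

theorem abs_mul_label_le_of_mem_box {q : (Fin d → ℝ) × ℝ} (hq : q ∈ box d X Y R) (k : Fin d) :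
    |q.1 k * q.2| ≤ X * Y := by
  rw [abs_mul]
  exact mul_le_mul (hq.1 k) hq.2.1 (abs_nonneg _) ((abs_nonneg _).trans (hq.1 k))

theorem abs_label_sq_le_of_mem_box {q : (Fin d → ℝ) × ℝ} (hq : q ∈ box d X Y R) :
    |q.2 ^ 2| ≤ Y ^ 2 := by
  rw [abs_pow]
  exact pow_le_pow_left₀ (abs_nonneg _) hq.2.1 2

theorem IsBoundedLaw.integrable_mul (hD : IsBoundedLaw D X Y R) (k l : Fin d) :
    Integrable (fun q => q.1 k * q.1 l) D :=
  have := hD.prob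
  integrable_of_abs_le_on hD.ae_mem (by fun_prop) fun _ hq => abs_mul_le_of_mem_box hq k l

theorem IsBoundedLaw.integrable_mul_label (hD : IsBoundedLaw D X Y R) (k : Fin d) :
    Integrable (fun q => q.1 k * q.2) D :=
  have := hD.prob
  integrable_of_abs_le_on hD.ae_mem (by fun_prop) fun _ hq => abs_mul_label_le_of_mem_box hq k

theorem IsBoundedLaw.integrable_label_sq (hD : IsBoundedLaw D X Y R) :
    Integrable (fun q => q.2 ^ 2) D :=
  have := hD.prob
  integrable_of_abs_le_on hD.ae_mem (by fun_prop) fun _ hq => abs_label_sq_le_of_mem_box hq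

/-- The deviation of the risk of a linear predictor in terms of the deviations of the moments. -/
theorem IsBoundedLaw.dev_loss (hD : IsBoundedLaw D X Y R) (β : Fin d → ℝ)
    (z : Fin m → (Fin d → ℝ) × ℝ) :
    dev D (fun q => (linPred β q.1 - q.2) ^ 2) z
      = ∑ k, ∑ l, β k * β l * dev D (fun q => q.1 k * q.1 l) z
        - ∑ k, 2 * β k * dev D (fun q => q.1 k * q.2) z + dev D (fun q => q.2 ^ 2) z := by
  have h1 : ∀ k l, Integrable (fun q : (Fin d → ℝ) × ℝ => β k * β l * (q.1 k * q.1 l)) D :=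
    fun k l => (hD.integrable_mul k l).const_mul (β k * β l)
  have h2 : ∀ k, Integrable (fun q : (Fin d → ℝ) × ℝ => 2 * β k * (q.1 k * q.2)) D :=
    fun k => (hD.integrable_mul_label k).const_mul (2 * β k)
  have h1' : ∀ k, Integrable (fun q : (Fin d → ℝ) × ℝ => ∑ l, β k * β l * (q.1 k * q.1 l)) D :=
    fun k => integrable_finsetSum Finset.univ fun l _ => h1 k l
  have h1'' : Integrable
      (fun q : (Fin d → ℝ) × ℝ => ∑ k, ∑ l, β k * β l * (q.1 k * q.1 l)) D :=
    integrable_finsetSum Finset.univ fun k _ => h1' k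
  have h2' : Integrable (fun q : (Fin d → ℝ) × ℝ => ∑ k, 2 * β k * (q.1 k * q.2)) D :=
    integrable_finsetSum Finset.univ fun k _ => h2 k
  have e1 := dev_sum h1' z
  have e2 := dev_sum h2 z
  have e3 := dev_sub h1'' h2' z
  have h3 : Integrable (fun q : (Fin d → ℝ) × ℝ => ∑ k, ∑ l, β k * β l * (q.1 k * q.1 l)
    - ∑ k, 2 * β k * (q.1 k * q.2)) D := h1''.sub h2'
  have e4 := dev_add h3 hD.integrable_label_sq z
  have e5 : ∀ k, dev D (fun q => ∑ l, β k * β l * (q.1 k * q.1 l)) z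
      = ∑ l, β k * β l * dev D (fun q => q.1 k * q.1 l) z := fun k => by
    rw [dev_sum (h1 k) z]
    exact Finset.sum_congr rfl fun l _ => dev_const_mul _ _ z
  have e6 : ∀ k, dev D (fun q => 2 * β k * (q.1 k * q.2)) z
      = 2 * β k * dev D (fun q => q.1 k * q.2) z := fun k => dev_const_mul _ _ z
  simp_rw [sq_linPred_sub]
  rw [e4, e3, e1, e2, Finset.sum_congr rfl fun k _ => e5 k, Finset.sum_congr rfl fun k _ => e6 k]

theorem mse_sub_empMSE (f : (Fin d → ℝ) → ℝ) (z : Fin m → (Fin d → ℝ) × ℝ) :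
    mse D f - empMSE z f = dev D (fun q => (f q.1 - q.2) ^ 2) z := rfl

theorem continuous_dev {φ : (Fin d → ℝ) × ℝ → ℝ} (hφ : Continuous φ) :
    Continuous (dev D φ : (Fin m → (Fin d → ℝ) × ℝ) → ℝ) := by
  unfold dev avg
  fun_prop

theorem abs_linPred_le {β : Fin d → ℝ} {Λ : ℝ} (hβ : ∑ k, |β k| ≤ Λ) {x : Fin d → ℝ}
    (hX : 0 ≤ X) (hx : ∀ k, |x k| ≤ X) : |linPred β x| ≤ Λ * X := by
  calc |linPred β x| ≤ ∑ k, |β k * x k| := Finset.abs_sum_le_sum_abs _ _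
    _ ≤ ∑ k, |β k| * X := Finset.sum_le_sum fun k _ => by
        rw [abs_mul]; exact mul_le_mul_of_nonneg_left (hx k) (abs_nonneg _)
    _ = (∑ k, |β k|) * X := (Finset.sum_mul _ _ _).symm
    _ ≤ Λ * X := mul_le_mul_of_nonneg_right hβ hX

theorem loss_le_of_mem_box {β : Fin d → ℝ} {Λ : ℝ} (hβ : ∑ k, |β k| ≤ Λ) (hX : 0 ≤ X)
    {q : (Fin d → ℝ) × ℝ} (hq : q ∈ box d X Y R) :
    (linPred β q.1 - q.2) ^ 2 ≤ (Λ * X + Y) ^ 2 := by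
  have h : |linPred β q.1 - q.2| ≤ Λ * X + Y :=
    (abs_sub _ _).trans (add_le_add (abs_linPred_le hβ hX hq.1) hq.2.1)
  rw [← sq_abs]
  exact pow_le_pow_left₀ (abs_nonneg _) h 2

/-- The empirical risk of a fixed predictor is not much larger than its risk. -/
theorem IsBoundedLaw.measureReal_empMSE_gt_le (hD : IsBoundedLaw D X Y R) (hm : 0 < m)
    (hX : 0 ≤ X) {β : Fin d → ℝ} {Λ : ℝ} (hβ : ∑ k, |β k| ≤ Λ)
    {δ : ℝ} (hδ : δ ∈ Set.Ioo (0 : ℝ) 1) :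
    (Measure.pi fun _ => D).real {z : Fin m → (Fin d → ℝ) × ℝ |
      mse D (linPred β) + (Λ * X + Y) ^ 2 * √(Real.log (1 / δ) / (2 * m)) < empMSE z (linPred β)}
      ≤ δ := by
  have := hD.prob
  refine measureReal_avg_gt_le (measurableSet_box d X Y R) hD.ae_mem hm
    (φ := fun q => (linPred β q.1 - q.2) ^ 2) ?_ (by positivity) (fun _ _ => sq_nonneg _)
    (fun q hq => loss_le_of_mem_box hβ hX hq) hδ
  unfold linPred
  fun_prop

/-! ### Uniform convergence on an L¹ ball -/

/-- The coefficient vectors of `L¹` norm at most `Λ`. -/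
def l1Ball (d : ℕ) (Λ : ℝ) : Set (Fin d → ℝ) := {β | ∑ k, |β k| ≤ Λ}

theorem isCompact_l1Ball (d : ℕ) (Λ : ℝ) : IsCompact (l1Ball d Λ) := by
  refine Metric.isCompact_of_isClosed_isBounded
    (isClosed_le (by fun_prop) continuous_const) ?_
  refine (Metric.isBounded_closedBall (x := (0 : Fin d → ℝ)) (r := |Λ|)).subset fun β hβ => ?_
  rw [mem_closedBall_zero_iff, pi_norm_le_iff_of_nonneg (abs_nonneg _)]
  intro k
  have h1 : |β k| ≤ ∑ k, |β k| :=
    Finset.single_le_sum (f := fun k => |β k|) (fun _ _ => abs_nonneg _) (Finset.mem_univ k)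
  exact h1.trans (le_trans hβ (le_abs_self _))

/-- The largest amount by which the risk of a linear predictor exceeds its empirical risk. -/
noncomputable def supGap (D : Measure ((Fin d → ℝ) × ℝ)) (Λ : ℝ)
    (z : Fin m → (Fin d → ℝ) × ℝ) : ℝ :=
  sSup ((fun β => dev D (fun q => (linPred β q.1 - q.2) ^ 2) z) '' l1Ball d Λ)

/-- Joint continuity and compactness of the ball make the uncountable supremum `supGap` continuous
in the sample, hence measurable. -/
theorem IsBoundedLaw.continuous_gap (hD : IsBoundedLaw D X Y R) :
    Continuous (fun q : (Fin m → (Fin d → ℝ) × ℝ) × (Fin d → ℝ) =>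
      dev D (fun r => (linPred q.2 r.1 - r.2) ^ 2) q.1) := by
  simp_rw [hD.dev_loss]
  have h1 : ∀ k l, Continuous fun q : (Fin m → (Fin d → ℝ) × ℝ) × (Fin d → ℝ) =>
      dev D (fun r => r.1 k * r.1 l) q.1 := fun k l => (continuous_dev (by fun_prop)).comp continuous_fst
  have h2 : ∀ k, Continuous fun q : (Fin m → (Fin d → ℝ) × ℝ) × (Fin d → ℝ) =>
      dev D (fun r => r.1 k * r.2) q.1 := fun k => (continuous_dev (by fun_prop)).comp continuous_fst
  have h3 : Continuous fun q : (Fin m → (Fin d → ℝ) × ℝ) × (Fin d → ℝ) =>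
      dev D (fun r => r.2 ^ 2) q.1 := (continuous_dev (by fun_prop)).comp continuous_fst
  fun_prop

theorem IsBoundedLaw.continuous_supGap (hD : IsBoundedLaw D X Y R) (Λ : ℝ) :
    Continuous (supGap D Λ : (Fin m → (Fin d → ℝ) × ℝ) → ℝ) :=
  (isCompact_l1Ball d Λ).continuous_sSup hD.continuous_gap

theorem IsBoundedLaw.dev_le_supGap (hD : IsBoundedLaw D X Y R) {Λ : ℝ} {β : Fin d → ℝ}
    (hβ : ∑ k, |β k| ≤ Λ) (z : Fin m → (Fin d → ℝ) × ℝ) :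
    dev D (fun q => (linPred β q.1 - q.2) ^ 2) z ≤ supGap D Λ z := by
  refine le_csSup ?_ ⟨β, hβ, rfl⟩
  exact ((isCompact_l1Ball d Λ).image
    (hD.continuous_gap.comp (Continuous.prodMk_right z))).bddAbove

theorem supGap_le {Λ : ℝ} (hΛ : 0 ≤ Λ) {z : Fin m → (Fin d → ℝ) × ℝ} {c : ℝ}
    (h : ∀ β : Fin d → ℝ, ∑ k, |β k| ≤ Λ → dev D (fun q => (linPred β q.1 - q.2) ^ 2) z ≤ c) :
    supGap D Λ z ≤ c := by
  refine csSup_le ⟨_, 0, by simpa [l1Ball] using hΛ, rfl⟩ ?_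
  rintro _ ⟨β, hβ, rfl⟩
  exact h β hβ

/-- By `dev_loss` and the `L¹` bound, the gap is at most `Λ ^ 2` times the largest deviation of the
products `x_k x_l`, plus `2 * Λ` times that of the `x_k y`, plus the deviation of `y ^ 2`. The last
has mean zero, and the maximal inequality handles the others. No symmetrization is needed. -/
theorem IsBoundedLaw.integral_supGap_le (hD : IsBoundedLaw D X Y R) (hd : 2 ≤ d) (hm : 0 < m)
    (hX : 0 ≤ X) (hY : 0 ≤ Y) {Λ : ℝ} (hΛ : 0 ≤ Λ)
    (hint : Integrable (supGap D Λ) (Measure.pi fun _ : Fin m => D)) :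
    ∫ z, supGap D Λ z ∂(Measure.pi fun _ : Fin m => D)
      ≤ 8 * (Λ * X + Y) * (Λ * X) * √(Real.log d / m) := by
  have := hD.prob
  have : Nonempty (Fin d) := ⟨⟨0, by omega⟩⟩
  have hm' : (0 : ℝ) < m := by exact_mod_cast hm
  have hd' : (2 : ℝ) ≤ d := by exact_mod_cast hd
  have hB := measurableSet_box d X Y R
  obtain ⟨H1, hi1, hb1, he1⟩ := exists_integrable_bound_dev (m := m) hB hD.ae_mem hm
    (φ := fun (p : Fin d × Fin d) q => q.1 p.1 * q.1 p.2) (fun p => by fun_prop)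
    (sq_nonneg X) (fun p q hq => abs_mul_le_of_mem_box hq p.1 p.2)
  obtain ⟨H2, hi2, hb2, he2⟩ := exists_integrable_bound_dev (m := m) hB hD.ae_mem hm
    (φ := fun (k : Fin d) q => q.1 k * q.2) (fun p => by fun_prop)
    (mul_nonneg hX hY) (fun k q hq => abs_mul_label_le_of_mem_box hq k)
  have hyy := hD.integrable_label_sq
  have hi3 : Integrable (dev D (fun q : (Fin d → ℝ) × ℝ => q.2 ^ 2))
      (Measure.pi fun _ : Fin m => D) := (integrable_const _).sub (integrable_avg hyy)
  have hpt : ∀ᵐ z ∂(Measure.pi fun _ : Fin m => D),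
      supGap D Λ z ≤ Λ ^ 2 * H1 z + 2 * Λ * H2 z + dev D (fun q => q.2 ^ 2) z := by
    filter_upwards [ae_pi_mem hD.ae_mem m] with z hz
    have hH1 : 0 ≤ H1 z := (abs_nonneg _).trans (hb1 z hz (Classical.arbitrary _))
    have hH2 : 0 ≤ H2 z := (abs_nonneg _).trans (hb2 z hz (Classical.arbitrary _))
    refine supGap_le hΛ fun β hβ => ?_
    rw [hD.dev_loss]
    have t1 : ∑ k, ∑ l, β k * β l * dev D (fun q => q.1 k * q.1 l) z ≤ Λ ^ 2 * H1 z := by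
      calc _ ≤ ∑ k, ∑ l, |β k| * |β l| * H1 z := by
            refine Finset.sum_le_sum fun k _ => Finset.sum_le_sum fun l _ => ?_
            refine (le_abs_self _).trans ?_
            rw [abs_mul, abs_mul]
            exact mul_le_mul_of_nonneg_left (hb1 z hz (k, l)) (by positivity)
        _ = (∑ k, |β k|) ^ 2 * H1 z := by
            rw [sq, Finset.sum_mul_sum, Finset.sum_mul]
            simp_rw [Finset.sum_mul]
        _ ≤ _ := by gcongr
    have t2 : -∑ k, 2 * β k * dev D (fun q => q.1 k * q.2) z ≤ 2 * Λ * H2 z := by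
      calc _ ≤ |∑ k, 2 * β k * dev D (fun q => q.1 k * q.2) z| := neg_le_abs _
        _ ≤ ∑ k, |2 * β k * dev D (fun q => q.1 k * q.2) z| := Finset.abs_sum_le_sum_abs _ _
        _ ≤ ∑ k, 2 * |β k| * H2 z := by
            refine Finset.sum_le_sum fun k _ => ?_
            rw [abs_mul, abs_mul, abs_two]
            exact mul_le_mul_of_nonneg_left (hb2 z hz k) (by positivity)
        _ = 2 * (∑ k, |β k|) * H2 z := by rw [Finset.mul_sum, Finset.sum_mul]
        _ ≤ _ := by gcongr
    linarith
  have hlogd : 0 < Real.log d := Real.log_pos (by linarith)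
  have hlog2 : Real.log 2 ≤ Real.log d := Real.log_le_log (by norm_num) hd'
  set σ := √(Real.log d / m) with hσ
  have hσ0 : 0 ≤ σ := Real.sqrt_nonneg _
  -- As `2 ≤ d`, `2 * log (2 * d ^ 2) ≤ 6 * log d ≤ 16 * log d`.
  have b1 : √(2 * Real.log (2 * (Fintype.card (Fin d × Fin d) : ℕ)) / m) ≤ 4 * σ := by
    rw [hσ, show (4 : ℝ) = √16 by rw [show (16 : ℝ) = 4 ^ 2 by norm_num]; simp,
      ← Real.sqrt_mul (by norm_num)]
    apply Real.sqrt_le_sqrt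
    rw [Fintype.card_prod, Fintype.card_fin]
    push_cast
    rw [Real.log_mul (by norm_num) (by positivity), Real.log_mul (by positivity) (by positivity),
      mul_div_assoc']
    exact div_le_div_of_nonneg_right (by linarith) hm'.le
  have b2 : √(2 * Real.log (2 * (Fintype.card (Fin d) : ℕ)) / m) ≤ 2 * σ := by
    rw [hσ, show (2 : ℝ) * √(Real.log d / m) = √4 * √(Real.log d / m) by
      rw [show (4 : ℝ) = 2 ^ 2 by norm_num]; simp, ← Real.sqrt_mul (by norm_num)]
    apply Real.sqrt_le_sqrt
    rw [Fintype.card_fin, Real.log_mul (by norm_num) (by positivity), mul_div_assoc']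
    exact div_le_div_of_nonneg_right (by linarith) hm'.le
  calc _ ≤ ∫ z, (Λ ^ 2 * H1 z + 2 * Λ * H2 z + dev D (fun q => q.2 ^ 2) z)
          ∂(Measure.pi fun _ : Fin m => D) :=
        integral_mono_ae hint (((hi1.const_mul _).add (hi2.const_mul _)).add hi3) hpt
    _ = Λ ^ 2 * ∫ z, H1 z ∂(Measure.pi fun _ : Fin m => D)
          + 2 * Λ * ∫ z, H2 z ∂(Measure.pi fun _ : Fin m => D) := by
        rw [integral_add (f := fun z => Λ ^ 2 * H1 z + 2 * Λ * H2 z)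
            ((hi1.const_mul _).add (hi2.const_mul _)) hi3, integral_add (hi1.const_mul _) (hi2.const_mul _), integral_const_mul,
          integral_const_mul, integral_dev hm hyy, add_zero]
    _ ≤ Λ ^ 2 * (X ^ 2 * (4 * σ)) + 2 * Λ * (X * Y * (2 * σ)) := by
        gcongr
        · exact he1.trans (by gcongr)
        · exact he2.trans (by gcongr)
    _ ≤ _ := by nlinarith [mul_nonneg (sq_nonneg (Λ * X)) hσ0,
        mul_nonneg (mul_nonneg (mul_nonneg hΛ hX) hY) hσ0]

/-- Uniform convergence of the empirical risk on an `L¹` ball. -/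
theorem IsBoundedLaw.measureReal_supGap_gt_le (hD : IsBoundedLaw D X Y R) (hd : 2 ≤ d)
    (hm : 0 < m) (hX : 0 ≤ X) (hY : 0 ≤ Y) {Λ : ℝ} (hΛ : 0 ≤ Λ)
    {δ : ℝ} (hδ : δ ∈ Set.Ioo (0 : ℝ) 1) :
    (Measure.pi fun _ => D).real {z : Fin m → (Fin d → ℝ) × ℝ |
      8 * (Λ * X + Y) * (Λ * X) * √(Real.log d / m)
        + (Λ * X + Y) ^ 2 * √(Real.log (1 / δ) / (2 * m)) < supGap D Λ z} ≤ δ := by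
  have := hD.prob
  have hm' : (0 : ℝ) < m := by exact_mod_cast hm
  have hloss : ∀ β : Fin d → ℝ, ∑ k, |β k| ≤ Λ → ∀ q ∈ box d X Y R,
      |(linPred β q.1 - q.2) ^ 2| ≤ (Λ * X + Y) ^ 2 := fun β hβ q hq => by
    rw [abs_of_nonneg (sq_nonneg _)]
    exact loss_le_of_mem_box hβ hX hq
  have hdev : ∀ β : Fin d → ℝ, ∑ k, |β k| ≤ Λ → ∀ z : Fin m → (Fin d → ℝ) × ℝ,
      (∀ j, z j ∈ box d X Y R) → |dev D (fun q => (linPred β q.1 - q.2) ^ 2) z|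
        ≤ (Λ * X + Y) ^ 2 + (Λ * X + Y) ^ 2 := fun β hβ z hz => by
    exact (abs_sub _ _).trans (add_le_add (abs_integral_le_of_abs_le_on hD.ae_mem (hloss β hβ))
      (abs_avg_le hm (hloss β hβ) hz))
  have hbd : ∀ z : Fin m → (Fin d → ℝ) × ℝ, (∀ j, z j ∈ box d X Y R) →
      |supGap D Λ z| ≤ (Λ * X + Y) ^ 2 + (Λ * X + Y) ^ 2 := by
    intro z hz
    refine abs_le.2 ⟨?_, supGap_le hΛ fun β hβ => (abs_le.1 (hdev β hβ z hz)).2⟩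
    have h0 : ∑ k, |(0 : Fin d → ℝ) k| ≤ Λ := by simpa using hΛ
    exact (abs_le.1 (hdev 0 h0 z hz)).1.trans (hD.dev_le_supGap h0 z)
  have hmeas := (hD.continuous_supGap (m := m) Λ).measurable
  have hstep : ∀ z w : Fin m → (Fin d → ℝ) × ℝ, (∀ β : Fin d → ℝ, ∑ k, |β k| ≤ Λ →
      |dev D (fun q => (linPred β q.1 - q.2) ^ 2) z - dev D (fun q => (linPred β q.1 - q.2) ^ 2) w|
        ≤ (Λ * X + Y) ^ 2 / m) → supGap D Λ z ≤ supGap D Λ w + (Λ * X + Y) ^ 2 / m := by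
    intro z w h
    refine supGap_le hΛ fun β hβ => ?_
    have := (abs_le.1 (h β hβ)).2
    linarith [hD.dev_le_supGap hβ w]
  refine measureReal_add_sqrt_lt_le D (measurableSet_box d X Y R) hD.ae_mem
    (c := (Λ * X + Y) ^ 2) (sq_nonneg _) hm hmeas
    hbd (fun z i a ha hz => ?_) hδ ?_
  -- The loss lies in `[0, (Λ * X + Y) ^ 2]` on the box, so one sample point moves every gap, and
  -- hence their supremum, by at most this length over `m`.
  · have key : ∀ β : Fin d → ℝ, ∑ k, |β k| ≤ Λ →
        |dev D (fun q => (linPred β q.1 - q.2) ^ 2) (Function.update z i a)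
          - dev D (fun q => (linPred β q.1 - q.2) ^ 2) z| ≤ (Λ * X + Y) ^ 2 / m := by
      intro β hβ
      unfold dev
      rw [sub_sub_sub_cancel_left, abs_sub_comm, avg_update_sub, abs_div, abs_of_pos hm']
      gcongr
      have h1 := loss_le_of_mem_box hβ hX ha
      have h2 := loss_le_of_mem_box hβ hX (hz i)
      rw [abs_le]
      constructor <;> nlinarith [sq_nonneg (linPred β a.1 - a.2),
        sq_nonneg (linPred β (z i).1 - (z i).2)]
    have h1 := hstep (Function.update z i a) z key
    have h2 := hstep z (Function.update z i a) fun β hβ => by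
      rw [abs_sub_comm]; exact key β hβ
    rw [abs_le]
    constructor <;> linarith
  · gcongr
    exact hD.integral_supGap_le hd hm hX hY hΛ (Integrable.of_bound
      hmeas.aestronglyMeasurable _ ((ae_pi_mem hD.ae_mem m).mono hbd))

/-! ### Concentration of the second moment matrix -/

/-- The Frobenius norm of the deviation of the second moment matrix. -/
noncomputable def covDev (D : Measure ((Fin d → ℝ) × ℝ)) (z : Fin m → (Fin d → ℝ) × ℝ) : ℝ :=
  ‖WithLp.toLp 2 fun p : Fin d × Fin d => dev D (fun q => q.1 p.1 * q.1 p.2) z‖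

theorem covDev_sq (D : Measure ((Fin d → ℝ) × ℝ)) (z : Fin m → (Fin d → ℝ) × ℝ) :
    covDev D z ^ 2 = ∑ p : Fin d × Fin d, dev D (fun q => q.1 p.1 * q.1 p.2) z ^ 2 := by
  rw [covDev, EuclideanSpace.norm_sq_eq]
  simp

theorem continuous_covDev (D : Measure ((Fin d → ℝ) × ℝ)) :
    Continuous (covDev D : (Fin m → (Fin d → ℝ) × ℝ) → ℝ) := by
  have : ∀ k l, Continuous (dev D (fun q => q.1 k * q.1 l) : (Fin m → (Fin d → ℝ) × ℝ) → ℝ) :=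
    fun k l => continuous_dev (by fun_prop)
  unfold covDev
  fun_prop

theorem norm_outer_le {q : (Fin d → ℝ) × ℝ} (hq : q ∈ box d X Y R) :
    ‖WithLp.toLp 2 fun p : Fin d × Fin d => q.1 p.1 * q.1 p.2‖ ≤ R := by
  have h0 : 0 ≤ ∑ k, q.1 k ^ 2 := Finset.sum_nonneg fun _ _ => sq_nonneg _
  refine (pow_le_pow_iff_left₀ (norm_nonneg _) (h0.trans hq.2.2) two_ne_zero).1 ?_
  rw [EuclideanSpace.norm_sq_eq, Fintype.sum_prod_type]
  have : ∑ k, ∑ l, ‖q.1 k * q.1 l‖ ^ 2 = (∑ k, q.1 k ^ 2) ^ 2 := by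
    rw [sq, Finset.sum_mul_sum]
    simp [mul_pow]
  simp only [this]
  exact pow_le_pow_left₀ h0 hq.2.2 2

/-- The entries' variances sum to at most `𝔼 ‖x xᵀ‖² / m ≤ R ^ 2 / m`, because the Frobenius norm of
`x xᵀ` is `‖x‖₂ ^ 2`. -/
theorem IsBoundedLaw.integral_covDev_le (hD : IsBoundedLaw D X Y R) (hm : 0 < m) (hR : 0 < R) :
    Integrable (covDev D) (Measure.pi fun _ : Fin m => D) ∧
    ∫ z, covDev D z ∂(Measure.pi fun _ : Fin m => D) ≤ R / √m := by
  have := hD.prob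
  have hm' : (0 : ℝ) < m := by exact_mod_cast hm
  have hbd : ∀ k l, ∀ z : Fin m → (Fin d → ℝ) × ℝ, (∀ j, z j ∈ box d X Y R) →
      |dev D (fun q => q.1 k * q.1 l) z| ≤ X ^ 2 + X ^ 2 := fun k l z hz =>
    (abs_sub _ _).trans (add_le_add
      (abs_integral_le_of_abs_le_on hD.ae_mem fun q hq => abs_mul_le_of_mem_box hq k l)
      (abs_avg_le hm (fun q hq => abs_mul_le_of_mem_box hq k l) hz))
  have hint : ∀ k l, Integrable (fun z : Fin m → (Fin d → ℝ) × ℝ =>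
      dev D (fun q => q.1 k * q.1 l) z ^ 2) (Measure.pi fun _ : Fin m => D) := fun k l => by
    refine Integrable.of_bound (C := (X ^ 2 + X ^ 2) ^ 2)
      ((measurable_dev (by fun_prop)).pow_const 2).aestronglyMeasurable
      ((ae_pi_mem hD.ae_mem m).mono fun z hz => ?_)
    rw [norm_pow]
    exact pow_le_pow_left₀ (norm_nonneg _) (hbd k l z hz) 2
  have hsq : Integrable (fun z => covDev D z ^ 2) (Measure.pi fun _ : Fin m => D) := by
    simp_rw [covDev_sq]
    exact integrable_finsetSum _ fun p _ => hint p.1 p.2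
  have hmem : ∀ k l, MemLp (fun q : (Fin d → ℝ) × ℝ => q.1 k * q.1 l) 2 D := fun k l =>
    MemLp.of_bound (by fun_prop) (X ^ 2) (hD.ae_mem.mono fun q hq => abs_mul_le_of_mem_box hq k l)
  have hE2 : ∫ z, covDev D z ^ 2 ∂(Measure.pi fun _ : Fin m => D) ≤ R ^ 2 / m := by
    simp_rw [covDev_sq]
    rw [integral_finsetSum _ fun p _ => hint p.1 p.2]
    calc _ ≤ ∑ p : Fin d × Fin d, (∫ q, (q.1 p.1 * q.1 p.2) ^ 2 ∂D) / m :=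
          Finset.sum_le_sum fun p _ => integral_dev_sq_le hm (hmem p.1 p.2)
      _ = (∫ q, ∑ p : Fin d × Fin d, (q.1 p.1 * q.1 p.2) ^ 2 ∂D) / m := by
          rw [integral_finsetSum _ fun p _ => (hmem p.1 p.2).integrable_sq, Finset.sum_div]
      _ ≤ R ^ 2 / m := by
          gcongr
          refine (le_abs_self _).trans (abs_integral_le_of_abs_le_on hD.ae_mem fun q hq => ?_)
          rw [abs_of_nonneg (Finset.sum_nonneg fun _ _ => sq_nonneg _)]
          have := pow_le_pow_left₀ (norm_nonneg _) (norm_outer_le hq) 2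
          rw [EuclideanSpace.norm_sq_eq] at this
          simpa only [Real.norm_eq_abs, sq_abs] using this
  have hF : Integrable (covDev D) (Measure.pi fun _ : Fin m => D) := by
    refine ((integrable_const (1 : ℝ)).add hsq).mono'
      (continuous_covDev D).measurable.aestronglyMeasurable (ae_of_all _ fun z => ?_)
    have : 0 ≤ covDev D z := norm_nonneg _
    rw [Real.norm_of_nonneg this]
    simp only [Pi.add_apply]
    nlinarith [sq_nonneg (covDev D z - 1)]
  refine ⟨hF, ?_⟩
  -- The passage from second to first moment is `2 * a * F ≤ F ^ 2 + a ^ 2`, with `a` equal to the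
  -- target bound.
  set a := R / √m with ha
  have ha0 : 0 < a := by positivity
  have ha2 : a ^ 2 = R ^ 2 / m := by rw [ha, div_pow, Real.sq_sqrt hm'.le]
  have h1 : 2 * a * ∫ z, covDev D z ∂(Measure.pi fun _ : Fin m => D)
      ≤ ∫ z, (covDev D z ^ 2 + a ^ 2) ∂(Measure.pi fun _ : Fin m => D) := by
    rw [← integral_const_mul]
    exact integral_mono (hF.const_mul _) (hsq.add (integrable_const _)) fun z => by
      nlinarith [sq_nonneg (covDev D z - a)]
  rw [integral_add hsq (integrable_const _)] at h1
  simp only [integral_const, probReal_univ, smul_eq_mul, one_mul] at h1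
  have h2 : a * ∫ z, covDev D z ∂(Measure.pi fun _ : Fin m => D) ≤ a * a := by nlinarith
  exact le_of_mul_le_mul_left h2 ha0

/-- Concentration of the second moment matrix in the Frobenius norm. -/
theorem IsBoundedLaw.measureReal_covDev_gt_le (hD : IsBoundedLaw D X Y R) (hm : 0 < m)
    (hR : 0 < R) {δ : ℝ} (hδ : δ ∈ Set.Ioo (0 : ℝ) 1) :
    (Measure.pi fun _ => D).real {z : Fin m → (Fin d → ℝ) × ℝ |
      R / √m + 2 * R * √(Real.log (1 / δ) / (2 * m)) < covDev D z} ≤ δ := by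
  have := hD.prob
  have hm' : (0 : ℝ) < m := by exact_mod_cast hm
  have hbd : ∀ k l, ∀ z : Fin m → (Fin d → ℝ) × ℝ, (∀ j, z j ∈ box d X Y R) →
      |dev D (fun q => q.1 k * q.1 l) z| ≤ X ^ 2 + X ^ 2 := fun k l z hz =>
    (abs_sub _ _).trans (add_le_add
      (abs_integral_le_of_abs_le_on hD.ae_mem fun q hq => abs_mul_le_of_mem_box hq k l)
      (abs_avg_le hm (fun q hq => abs_mul_le_of_mem_box hq k l) hz))
  refine measureReal_add_sqrt_lt_le D (measurableSet_box d X Y R) hD.ae_mem (c := 2 * R)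
    (by positivity) hm (continuous_covDev D).measurable (C := 1 + ∑ _p : Fin d × Fin d, (X ^ 2 + X ^ 2) ^ 2)
    (fun z hz => ?_) (fun z i a ha hz => ?_) hδ ?_
  · have h0 : 0 ≤ covDev D z := norm_nonneg _
    rw [abs_of_nonneg h0]
    have : covDev D z ^ 2 ≤ ∑ _p : Fin d × Fin d, (X ^ 2 + X ^ 2) ^ 2 := by
      rw [covDev_sq]
      refine Finset.sum_le_sum fun p _ => ?_
      rw [← sq_abs]
      exact pow_le_pow_left₀ (abs_nonneg _) (hbd p.1 p.2 z hz) 2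
    nlinarith [sq_nonneg (covDev D z - 1)]
  · unfold covDev
    refine (abs_norm_sub_norm_le _ _).trans ?_
    rw [← WithLp.toLp_sub]
    have e : ((fun p : Fin d × Fin d => dev D (fun q => q.1 p.1 * q.1 p.2) (Function.update z i a))
        - fun p : Fin d × Fin d => dev D (fun q => q.1 p.1 * q.1 p.2) z)
        = (m : ℝ)⁻¹ • ((fun p : Fin d × Fin d => (z i).1 p.1 * (z i).1 p.2)
          - fun p : Fin d × Fin d => a.1 p.1 * a.1 p.2) := by
      ext p
      have := avg_update_sub (fun q : (Fin d → ℝ) × ℝ => q.1 p.1 * q.1 p.2) z i a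
      simp only [Pi.sub_apply, Pi.smul_apply, smul_eq_mul, dev]
      rw [sub_sub_sub_cancel_left, ← neg_sub, this]
      ring
    rw [e, WithLp.toLp_smul, norm_smul, WithLp.toLp_sub, norm_inv, Real.norm_of_nonneg hm'.le,
      inv_mul_eq_div]
    gcongr
    refine (norm_sub_le _ _).trans ?_
    linarith [norm_outer_le ha, norm_outer_le (hz i)]
  · gcongr
    exact (hD.integral_covDev_le hm hR).2

end

/-! ### Chains of least squares predictions in an inner product space -/

section InnerProduct
variable {H : Type*} [NormedAddCommGroup H] [InnerProductSpace ℝ H]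

theorem inner_eq_zero_of_forall_norm_le {a h : H} (hmin : ∀ s : ℝ, ‖a‖ ^ 2 ≤ ‖a + s • h‖ ^ 2) :
    inner ℝ a h = 0 := by
  by_cases h0 : h = 0
  · simp [h0]
  have hpos : 0 < ‖h‖ ^ 2 := by positivity
  have := hmin (-inner ℝ a h / ‖h‖ ^ 2)
  rw [norm_add_sq_real, inner_smul_right, norm_smul, mul_pow, Real.norm_eq_abs, sq_abs] at this
  have e : 2 * (-inner ℝ a h / ‖h‖ ^ 2 * inner ℝ a h) + (-inner ℝ a h / ‖h‖ ^ 2) ^ 2 * ‖h‖ ^ 2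
      = -(inner ℝ a h) ^ 2 / ‖h‖ ^ 2 := by field_simp; ring
  have h1 : 0 ≤ -(inner ℝ a h) ^ 2 / ‖h‖ ^ 2 := by linarith
  rw [le_div_iff₀ hpos] at h1
  nlinarith [sq_nonneg (inner ℝ a h)]

/-- Successive least squares residuals decrease by the squared distance of the predictions. -/
theorem norm_sub_sq_eq_of_orthogonal {u v y : H} (h1 : inner ℝ (v - y) v = 0)
    (h2 : inner ℝ (v - y) u = 0) : ‖u - y‖ ^ 2 = ‖v - y‖ ^ 2 + ‖v - u‖ ^ 2 := by
  have : u - y = (v - y) - (v - u) := by abel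
  rw [this, norm_sub_sq_real, inner_sub_right, h1, h2]
  ring

/-- Triangle inequality along the chain, then Cauchy–Schwarz over its `n` steps; by Pythagoras the
squared step lengths telescope to the total drop of the error. -/
theorem norm_sub_sq_le_of_chain {u : ℕ → H} {y : H} {n : ℕ}
    (hself : ∀ t ≤ n, inner ℝ (u t - y) (u t) = 0)
    (hprev : ∀ t < n, inner ℝ (u (t + 1) - y) (u t) = 0) {t : ℕ} (ht : t ≤ n) :
    ‖u n - u t‖ ^ 2 ≤ n * (‖u 0 - y‖ ^ 2 - ‖u n - y‖ ^ 2) := by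
  have hstep : ∀ s ∈ Finset.range n,
      ‖u (s + 1) - u s‖ ^ 2 = ‖u s - y‖ ^ 2 - ‖u (s + 1) - y‖ ^ 2 := fun s hs => by
    rw [Finset.mem_range] at hs
    linarith [norm_sub_sq_eq_of_orthogonal (hself (s + 1) hs) (hprev s hs)]
  have h1 : ‖u n - u t‖ ≤ ∑ s ∈ Finset.range n, ‖u (s + 1) - u s‖ := by
    calc ‖u n - u t‖ = dist (u t) (u n) := by rw [dist_eq_norm, norm_sub_rev]
      _ ≤ ∑ s ∈ Finset.Ico t n, dist (u s) (u (s + 1)) := dist_le_Ico_sum_dist u ht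
      _ ≤ ∑ s ∈ Finset.range n, dist (u s) (u (s + 1)) :=
          Finset.sum_le_sum_of_subset_of_nonneg
            (fun s hs => Finset.mem_range.2 (Finset.mem_Ico.1 hs).2) fun _ _ _ => dist_nonneg
      _ = _ := Finset.sum_congr rfl fun s _ => by rw [dist_eq_norm, norm_sub_rev]
  calc ‖u n - u t‖ ^ 2 ≤ (∑ s ∈ Finset.range n, ‖u (s + 1) - u s‖) ^ 2 :=
        pow_le_pow_left₀ (norm_nonneg _) h1 2
    _ ≤ (Finset.range n).card * ∑ s ∈ Finset.range n, ‖u (s + 1) - u s‖ ^ 2 :=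
        sq_sum_le_card_mul_sum_sq
    _ = _ := by
        rw [Finset.card_range, Finset.sum_congr rfl hstep,
          Finset.sum_range_sub' (fun s => ‖u s - y‖ ^ 2)]

/-- If the features are orthogonal to the residuals at some point of a chain of least squares
predictions, then the last prediction is nearly as good as any combination of the features. -/
theorem norm_sub_sq_le_of_chain_of_features {ι : Type*} [Fintype ι] {u : ℕ → H} {y : H} {n : ℕ}
    (hself : ∀ t ≤ n, inner ℝ (u t - y) (u t) = 0)
    (hprev : ∀ t < n, inner ℝ (u (t + 1) - y) (u t) = 0)
    {φ : ι → H} (hφ : ∀ k, ∃ t ≤ n, inner ℝ (u t - y) (φ k) = 0) {C : ℝ} (hC : 0 ≤ C)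
    (hφC : ∀ k, ‖φ k‖ ≤ C) {γ : ι → ℝ} {A : ℝ} (hγ : ∑ k, |γ k| ≤ A) :
    ‖u n - y‖ ^ 2 ≤ ‖∑ k, γ k • φ k - y‖ ^ 2
      + 2 * A * C * √(n * (‖u 0 - y‖ ^ 2 - ‖u n - y‖ ^ 2)) := by
  set g := ∑ k, γ k • φ k
  set Δ := √(n * (‖u 0 - y‖ ^ 2 - ‖u n - y‖ ^ 2))
  have hin : ∀ k, |inner ℝ (u n - y) (φ k)| ≤ Δ * C := by
    intro k
    obtain ⟨t, ht, h0⟩ := hφ k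
    -- The residual at `t` is orthogonal to the feature, so only the movement from `t` to `n`
    -- contributes.
    have e : inner ℝ (u n - y) (φ k) = inner ℝ (u n - u t) (φ k) := by
      rw [show u n - y = (u n - u t) + (u t - y) by abel, inner_add_left, h0, add_zero]
    rw [e]
    refine (abs_real_inner_le_norm _ _).trans (mul_le_mul ?_ (hφC k) (norm_nonneg _)
      (Real.sqrt_nonneg _))
    exact Real.le_sqrt_of_sq_le (norm_sub_sq_le_of_chain hself hprev ht)
  have hg : |inner ℝ (u n - y) g| ≤ A * (Δ * C) := by
    simp only [g, inner_sum, inner_smul_right]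
    calc _ ≤ ∑ k, |γ k * inner ℝ (u n - y) (φ k)| := Finset.abs_sum_le_sum_abs _ _
      _ ≤ ∑ k, |γ k| * (Δ * C) := Finset.sum_le_sum fun k _ => by
          rw [abs_mul]; exact mul_le_mul_of_nonneg_left (hin k) (abs_nonneg _)
      _ = (∑ k, |γ k|) * (Δ * C) := (Finset.sum_mul _ _ _).symm
      _ ≤ _ := mul_le_mul_of_nonneg_right hγ (mul_nonneg (Real.sqrt_nonneg _) hC)
  have e : ‖g - y‖ ^ 2 = ‖u n - y‖ ^ 2 + 2 * inner ℝ (u n - y) g + ‖g - u n‖ ^ 2 := by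
    rw [show g - y = (u n - y) + (g - u n) by abel, norm_add_sq_real, inner_sub_right,
      hself n le_rfl]
    ring
  nlinarith [(abs_le.1 hg).1, sq_nonneg ‖g - u n‖]

end InnerProduct

/-- Among `B` disjoint blocks, some block has at most a fraction `1 / B` of the total decrease. -/
theorem exists_block_sub_le {e : ℕ → ℝ} (he : Antitone e) (h0 : ∀ t, 0 ≤ e t) {B n : ℕ}
    (hB : 0 < B) : ∃ b < B, e (b * (n + 1)) - e (b * (n + 1) + n) ≤ e 0 / B := by
  by_contra! h
  have hB' : (0 : ℝ) < B := by exact_mod_cast hB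
  have h1 : ∑ b ∈ Finset.range B, e 0 / B
      < ∑ b ∈ Finset.range B, (e (b * (n + 1)) - e ((b + 1) * (n + 1))) := by
    refine Finset.sum_lt_sum_of_nonempty (Finset.nonempty_range_iff.2 hB.ne') fun b hb => ?_
    have := h b (Finset.mem_range.1 hb)
    -- The drop between the end of a block and the start of the next is discarded; it is
    -- nonnegative.
    have h2 : e ((b + 1) * (n + 1)) ≤ e (b * (n + 1) + n) := he (by linarith)
    linarith
  rw [Finset.sum_range_sub' (fun b => e (b * (n + 1)))] at h1
  simp only [Finset.sum_const, Finset.card_range, nsmul_eq_mul, zero_mul] at h1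
  rw [mul_div_cancel₀ _ hB'.ne'] at h1
  linarith [h0 (B * (n + 1))]

/-! ### Empirical guarantee along a path -/

section Fit
variable {V : Type*} [Fintype V] {d m : ℕ} {G : Digraph V} {S : V → Set (Fin d)}
  {f : V → (Fin d → ℝ) → ℝ}

/-- The normalized vector of the predictions of `f` on the dataset. -/
noncomputable def predVec (z : Fin m → (Fin d → ℝ) × ℝ) (f : (Fin d → ℝ) → ℝ) :
    EuclideanSpace ℝ (Fin m) := (√m)⁻¹ • WithLp.toLp 2 fun j => f (z j).1

/-- The normalized vector of the labels of the dataset. -/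
noncomputable def labelVec (z : Fin m → (Fin d → ℝ) × ℝ) : EuclideanSpace ℝ (Fin m) :=
  (√m)⁻¹ • WithLp.toLp 2 fun j => (z j).2

theorem norm_predVec_sq (z : Fin m → (Fin d → ℝ) × ℝ) (f : (Fin d → ℝ) → ℝ) :
    ‖predVec z f‖ ^ 2 = (∑ j, f (z j).1 ^ 2) / m := by
  rw [predVec, norm_smul, mul_pow, EuclideanSpace.norm_sq_eq, norm_inv, inv_pow,
    Real.norm_of_nonneg (Real.sqrt_nonneg _), Real.sq_sqrt (by positivity)]
  simp [inv_mul_eq_div]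

theorem norm_labelVec_sq (z : Fin m → (Fin d → ℝ) × ℝ) :
    ‖labelVec z‖ ^ 2 = (∑ j, (z j).2 ^ 2) / m := by
  rw [labelVec, norm_smul, mul_pow, EuclideanSpace.norm_sq_eq, norm_inv, inv_pow,
    Real.norm_of_nonneg (Real.sqrt_nonneg _), Real.sq_sqrt (by positivity)]
  simp [inv_mul_eq_div]

theorem empMSE_eq_norm (z : Fin m → (Fin d → ℝ) × ℝ) (f : (Fin d → ℝ) → ℝ) :
    empMSE z f = ‖predVec z f - labelVec z‖ ^ 2 := by
  rw [predVec, labelVec, ← smul_sub, ← WithLp.toLp_sub, norm_smul, mul_pow,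
    EuclideanSpace.norm_sq_eq, norm_inv, inv_pow,
    Real.norm_of_nonneg (Real.sqrt_nonneg _), Real.sq_sqrt (by positivity)]
  simp [inv_mul_eq_div, empMSE]

theorem predVec_add_mul (z : Fin m → (Fin d → ℝ) × ℝ) (f h : (Fin d → ℝ) → ℝ) (s : ℝ) :
    predVec z (fun x => f x + s * h x) = predVec z f + s • predVec z h := by
  ext j
  simp [predVec]
  ring

theorem predVec_linPred (z : Fin m → (Fin d → ℝ) × ℝ) (β : Fin d → ℝ) :
    predVec z (linPred β) = ∑ k, β k • predVec z fun x => x k := by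
  ext j
  simp [predVec, linPred, Finset.mul_sum]
  exact Finset.sum_congr rfl fun k _ => by ring

/-- First order optimality: the residual is orthogonal to every direction in which the predictor may
be moved. The admissible directions used below are the prediction itself, a parent's prediction and
an observed feature. -/
theorem IsLeastSquaresFit.inner_eq_zero {z : Fin m → (Fin d → ℝ) × ℝ}
    (hf : IsLeastSquaresFit (empMSE z) G S f) {i : V} {h : (Fin d → ℝ) → ℝ}
    (hh : ∀ s : ℝ, (fun x => f i x + s * h x) ∈ agentModels G S f i) :
    inner ℝ (predVec z (f i) - labelVec z) (predVec z h) = 0 := by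
  refine inner_eq_zero_of_forall_norm_le fun s => ?_
  have := (hf i).2 _ (hh s)
  rw [empMSE_eq_norm, empMSE_eq_norm, predVec_add_mul] at this
  rwa [sub_add_eq_add_sub]

theorem IsLeastSquaresFit.inner_self {z : Fin m → (Fin d → ℝ) × ℝ}
    (hf : IsLeastSquaresFit (empMSE z) G S f) (i : V) :
    inner ℝ (predVec z (f i) - labelVec z) (predVec z (f i)) = 0 := by
  refine hf.inner_eq_zero fun s => ?_
  obtain ⟨w, v, hw, hv, h⟩ := (hf i).1
  refine ⟨fun k => (1 + s) * w k, fun j => (1 + s) * v j, fun k hk => by simp [hw k hk],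
    fun j hj => by simp [hv j hj], fun x => ?_⟩
  simp_rw [mul_assoc]
  rw [← Finset.mul_sum, ← Finset.mul_sum, ← mul_add, ← h x]
  ring

theorem IsLeastSquaresFit.inner_parent {z : Fin m → (Fin d → ℝ) × ℝ}
    (hf : IsLeastSquaresFit (empMSE z) G S f) {i j : V} (hij : G.Adj j i) :
    inner ℝ (predVec z (f i) - labelVec z) (predVec z (f j)) = 0 := by
  classical
  refine hf.inner_eq_zero fun s => ?_
  obtain ⟨w, v, hw, hv, h⟩ := (hf i).1
  refine ⟨w, fun l => v l + if l = j then s else 0, hw, fun l hl => ?_, fun x => ?_⟩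
  · have : l ≠ j := by rintro rfl; exact hl hij
    simp [hv l hl, this]
  · simp_rw [add_mul]
    rw [Finset.sum_add_distrib, h x]
    simp [add_assoc]

theorem IsLeastSquaresFit.inner_feature {z : Fin m → (Fin d → ℝ) × ℝ}
    (hf : IsLeastSquaresFit (empMSE z) G S f) {i : V} {k : Fin d} (hk : k ∈ S i) :
    inner ℝ (predVec z (f i) - labelVec z) (predVec z fun x => x k) = 0 := by
  refine hf.inner_eq_zero fun s => ?_
  obtain ⟨w, v, hw, hv, h⟩ := (hf i).1
  refine ⟨fun l => w l + if l = k then s else 0, v, fun l hl => ?_, hv, fun x => ?_⟩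
  · have : l ≠ k := by rintro rfl; exact hl hk
    simp [hw l hl, this]
  · simp_rw [add_mul]
    rw [Finset.sum_add_distrib, h x]
    simp
    ring

theorem IsLeastSquaresFit.empMSE_le_zero {z : Fin m → (Fin d → ℝ) × ℝ}
    (hf : IsLeastSquaresFit (empMSE z) G S f) (i : V) :
    empMSE z (f i) ≤ empMSE z (linPred 0) :=
  (hf i).2 _ ⟨0, 0, by simp, by simp, by simp [linPred]⟩

theorem IsLeastSquaresFit.empMSE_le_parent {z : Fin m → (Fin d → ℝ) × ℝ}
    (hf : IsLeastSquaresFit (empMSE z) G S f) {i j : V} (hij : G.Adj j i) :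
    empMSE z (f i) ≤ empMSE z (f j) := by
  classical
  refine (hf i).2 _ ⟨0, fun l => if l = j then 1 else 0, by simp,
    fun l hl => if_neg (by rintro rfl; exact hl hij), by simp⟩

/-- Orthogonality of residual and prediction gives `‖u‖² = ⟪y, u⟫`, and Cauchy–Schwarz finishes. -/
theorem IsLeastSquaresFit.norm_predVec_le {z : Fin m → (Fin d → ℝ) × ℝ}
    (hf : IsLeastSquaresFit (empMSE z) G S f) (i : V) :
    ‖predVec z (f i)‖ ≤ ‖labelVec z‖ := by
  have h := hf.inner_self i
  rw [inner_sub_left, real_inner_self_eq_norm_sq, sub_eq_zero] at h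
  have := real_inner_le_norm (labelVec z) (predVec z (f i))
  rw [← h, sq] at this
  rcases (norm_nonneg (predVec z (f i))).eq_or_lt with h0 | h0
  · rw [← h0]; exact norm_nonneg _
  · exact le_of_mul_le_mul_right this h0

/-- In a DAG all agents use linear predictors. -/
theorem exists_eq_linPred (hG : IsDAG G) (hf : ∀ i, f i ∈ agentModels G S f i) (i : V) :
    ∃ β, f i = linPred β := by
  -- Acyclicity on finitely many agents makes ancestry well founded, so linearity can be passed from
  -- parents to children.
  have : Std.Irrefl (Relation.TransGen G.Adj) := ⟨hG⟩
  have hwf : WellFounded (Relation.TransGen G.Adj) := Finite.wellFounded_of_trans_of_irrefl _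
  induction i using hwf.induction with
  | _ i ih =>
    obtain ⟨w, v, -, hv, h⟩ := hf i
    have : ∀ j, ∃ β, ∀ x, v j * f j x = linPred β x := by
      intro j
      by_cases hj : G.Adj j i
      · obtain ⟨β, hβ⟩ := ih j (.single hj)
        refine ⟨fun k => v j * β k, fun x => ?_⟩
        simp only [hβ, linPred, Finset.mul_sum, mul_assoc]
      · exact ⟨0, fun x => by simp [hv j hj, linPred]⟩
    choose β hβ using this
    refine ⟨fun k => w k + ∑ j, β j k, ?_⟩
    ext x
    rw [h x]
    simp only [hβ, linPred, add_mul, Finset.sum_add_distrib, Finset.sum_mul]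
    rw [Finset.sum_comm]

theorem IsLeastSquaresFit.empMSE_path_antitone {z : Fin m → (Fin d → ℝ) × ℝ}
    (hf : IsLeastSquaresFit (empMSE z) G S f) {L : ℕ} {P : Fin L → V} (hP : IsPath G P)
    {i j : Fin L} (hij : i ≤ j) : empMSE z (f (P j)) ≤ empMSE z (f (P i)) := by
  obtain ⟨i, hi⟩ := i
  obtain ⟨j, hj⟩ := j
  replace hij : i ≤ j := hij
  induction j, hij using Nat.le_induction with
  | base => rfl
  | succ n hn ih => exact (hf.empMSE_le_parent (hP ⟨n, by omega⟩ ⟨n + 1, hj⟩ rfl)).trans (ih _)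

/-- The empirical guarantee along a path whose blocks of `n + 1` agents observe all features. -/
theorem IsLeastSquaresFit.exists_empMSE_le {z : Fin m → (Fin d → ℝ) × ℝ}
    (hf : IsLeastSquaresFit (empMSE z) G S f) {L : ℕ} {P : Fin L → V} (hP : IsPath G P)
    {B n : ℕ} (hB : 0 < B) (hL : B * (n + 1) ≤ L)
    (hcov : ∀ b < B, ∀ k, ∃ t : Fin L, b * (n + 1) ≤ t ∧ (t : ℕ) ≤ b * (n + 1) + n ∧ k ∈ S (P t))
    {C : ℝ} (hC : 0 ≤ C) (hφC : ∀ k, ‖predVec z fun x => x k‖ ≤ C)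
    {γ : Fin d → ℝ} {A : ℝ} (hγ : ∑ k, |γ k| ≤ A) :
    ∃ j : Fin L, (j : ℕ) + 1 ≤ B * (n + 1) ∧ empMSE z (f (P j)) ≤ empMSE z (linPred γ)
      + 2 * A * C * √(n * (empMSE z (linPred 0) / B)) := by
  have hL0 : 0 < L := lt_of_lt_of_le (by positivity) hL
  -- The path is continued beyond its end by repeating the last agent, so the errors form an
  -- antitone sequence on all of `ℕ`.
  set Q : ℕ → Fin L := fun t => ⟨min t (L - 1), by omega⟩ with hQ
  have hQle : ∀ t, (ht : t < L) → Q t = ⟨t, ht⟩ := fun t ht => by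
    simp only [hQ, Fin.mk.injEq]; omega
  obtain ⟨b, hb, hdrop⟩ := exists_block_sub_le (e := fun t => empMSE z (f (P (Q t))))
    (fun s t hst => hf.empMSE_path_antitone hP (by
      simp only [hQ, Fin.mk_le_mk]; omega))
    (fun t => by rw [empMSE_eq_norm]; positivity) (n := n) hB
  have hend : b * (n + 1) + n + 1 ≤ B * (n + 1) := by nlinarith
  have hlt : ∀ t ≤ n, b * (n + 1) + t < L := fun t ht => by omega
  refine ⟨⟨b * (n + 1) + n, hlt n le_rfl⟩, hend, ?_⟩
  have main := norm_sub_sq_le_of_chain_of_features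
    (u := fun t => predVec z (f (P (Q (b * (n + 1) + t))))) (y := labelVec z) (n := n)
    (φ := fun k => predVec z fun x => x k)
    (fun t _ => hf.inner_self _)
    (fun t ht => hf.inner_parent (by
      rw [hQle _ (hlt t ht.le), hQle _ (hlt (t + 1) ht)]
      exact hP _ _ rfl))
    (fun k => by
      obtain ⟨t, h1, h2, hk⟩ := hcov b hb k
      refine ⟨t - b * (n + 1), by omega, hf.inner_feature ?_⟩
      rw [show b * (n + 1) + (t - b * (n + 1)) = t by omega, hQle _ t.2]
      exact hk) hC hφC hγ
  simp only [← predVec_linPred, ← empMSE_eq_norm, add_zero] at main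
  rw [← hQle]
  have hA : 0 ≤ A := (Finset.sum_nonneg fun _ _ => abs_nonneg _).trans hγ
  refine main.trans ?_
  gcongr
  refine hdrop.trans ?_
  gcongr
  exact hf.empMSE_le_zero _

end Fit

/-- The agents of a block must be distinct for their feature sets to be independent. -/
theorem path_injective {V : Type*} {G : Digraph V} (hG : IsDAG G) {L : ℕ} {P : Fin L → V}
    (hP : IsPath G P) : Function.Injective P := by
  have key : ∀ (j : ℕ) (hj : j < L) (i : ℕ) (hij : i < j),
      Relation.TransGen G.Adj (P ⟨i, hij.trans hj⟩) (P ⟨j, hj⟩) := by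
    intro j hj i hij
    induction j, hij using Nat.le_induction with
    | base => exact .single (hP _ _ rfl)
    | succ n hn ih => exact (ih (by omega)).tail (hP ⟨n, by omega⟩ ⟨n + 1, hj⟩ rfl)
  intro i j h
  rcases lt_trichotomy (i : ℕ) j with hij | hij | hij
  · have := key j j.2 i hij
    rw [Fin.eta, Fin.eta, h] at this
    exact absurd this (hG _)
  · exact Fin.ext hij
  · have := key i i.2 j hij
    rw [Fin.eta, Fin.eta, h] at this
    exact absurd this (hG _)

/-! ### Coverage of all features by every block -/

section Coverage
variable {V Ω : Type*} [MeasurableSpace Ω] {μ : Measure Ω} [IsProbabilityMeasure μ] {d : ℕ}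
  {S : V → Ω → Set (Fin d)} {p : ℝ}

theorem IsRandomAllocation.measureReal_forall_notMem (hS : IsRandomAllocation μ S p)
    (T : Finset (V × Fin d)) :
    μ.real (⋂ q ∈ T, {ω | q.2 ∈ S q.1 ω}ᶜ) = (1 - p) ^ T.card := by
  have h := (iIndepSet_iff_iIndep _ _).1 hS.indep
  have := h.meas_biInter (S := T) (s := fun q => {ω | q.2 ∈ S q.1 ω}ᶜ) fun q _ =>
    (MeasurableSpace.measurableSet_generateFrom (Set.mem_singleton _)).compl
  rw [measureReal_def, this, ENNReal.toReal_prod]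
  simp_rw [← measureReal_def]
  rw [Finset.prod_congr rfl fun q _ =>
    (probReal_compl_eq_one_sub (hS.measurable q.1 q.2)).trans (by rw [hS.prob])]
  simp

/-- With high probability every block of a path observes all features. -/
theorem IsRandomAllocation.exists_coverage (hS : IsRandomAllocation μ S p) {L : ℕ} {P : Fin L → V}
    (hP : Function.Injective P) {B n : ℕ} (hL : B * (n + 1) ≤ L) :
    ∃ E : Set Ω, MeasurableSet E ∧ 1 - B * d * (1 - p) ^ (n + 1) ≤ μ.real E ∧
      ∀ ω ∈ E, ∀ b < B, ∀ k, ∃ t : Fin L,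
        b * (n + 1) ≤ t ∧ (t : ℕ) ≤ b * (n + 1) + n ∧ k ∈ S (P t) ω := by
  classical
  have hlt : ∀ (b : Fin B) (i : Fin (n + 1)), (b : ℕ) * (n + 1) + i < L := fun b i => by
    have h1 : ((b : ℕ) + 1) * (n + 1) ≤ B * (n + 1) := Nat.mul_le_mul_right _ b.2
    have h2 := i.2
    rw [add_mul] at h1
    omega
  -- For a block and a feature, the `n + 1` agent–feature pairs that must all fail for the block to
  -- miss the feature. The union bound runs over the `B * d` choices.
  set T : Fin B × Fin d → Finset (V × Fin d) := fun c =>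
    Finset.univ.image fun i : Fin (n + 1) => (P ⟨(c.1 : ℕ) * (n + 1) + i, hlt c.1 i⟩, c.2)
  have hT : ∀ c, (T c).card = n + 1 := fun c => by
    simp only [T]
    rw [Finset.card_image_of_injective, Finset.card_univ, Fintype.card_fin]
    intro i j hij
    have := hP (Prod.ext_iff.1 hij).1
    simp only [Fin.mk.injEq, add_right_inj] at this
    exact Fin.ext this
  have hm : MeasurableSet (⋃ c, ⋂ q ∈ T c, {ω | q.2 ∈ S q.1 ω}ᶜ) :=
    MeasurableSet.iUnion fun c => Finset.measurableSet_biInter _ fun q _ =>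
      (hS.measurable q.1 q.2).compl
  refine ⟨(⋃ c, ⋂ q ∈ T c, {ω | q.2 ∈ S q.1 ω}ᶜ)ᶜ, hm.compl, ?_, ?_⟩
  · rw [probReal_compl_eq_one_sub hm]
    have : μ.real (⋃ c, ⋂ q ∈ T c, {ω | q.2 ∈ S q.1 ω}ᶜ) ≤ B * d * (1 - p) ^ (n + 1) := by
      refine (measureReal_iUnion_fintype_le _).trans ?_
      simp_rw [hS.measureReal_forall_notMem, hT]
      simp
    linarith
  · intro ω hω b hb k
    by_contra! h
    refine hω (Set.mem_iUnion.2 ⟨(⟨b, hb⟩, k), Set.mem_iInter₂.2 fun q hq => ?_⟩)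
    obtain ⟨i, -, rfl⟩ := Finset.mem_image.1 hq
    have h2 := i.2
    exact h _ (by simp) (by dsimp only; omega)

end Coverage

/-! ### Smallest eigenvalue, coefficient bounds and the benchmark -/

section Law
variable {d m : ℕ} {D : Measure ((Fin d → ℝ) × ℝ)} {X Y R : ℝ}

/-- The Rayleigh quotient bound, by expansion in an orthonormal eigenbasis. -/
theorem lambdaMin_mul_le (D : Measure ((Fin d → ℝ) × ℝ)) (β : Fin d → ℝ) :
    lambdaMin D * ∑ k, β k ^ 2 ≤ ∑ k, ∑ l, β k * β l * covMatrix D k l := by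
  set hA := covMatrix_isHermitian D
  set b := hA.eigenvectorBasis
  set v : EuclideanSpace ℝ (Fin d) := WithLp.toLp 2 β
  set w : EuclideanSpace ℝ (Fin d) := WithLp.toLp 2 (Matrix.mulVec (covMatrix D) β)
  have hw : ∑ k, ∑ l, β k * β l * covMatrix D k l = inner ℝ v w := by
    simp only [v, w, PiLp.inner_apply, Matrix.mulVec, dotProduct, RCLike.inner_apply, conj_trivial]
    refine Finset.sum_congr rfl fun k _ => ?_
    rw [Finset.sum_mul]
    exact Finset.sum_congr rfl fun l _ => by ring
  have hbw : ∀ i, inner ℝ (b i) w = hA.eigenvalues i * inner ℝ (b i) v := by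
    intro i
    have h1 := hA.mulVec_eigenvectorBasis i
    have h2 : inner ℝ (b i) w = Matrix.mulVec (covMatrix D) (b i) ⬝ᵥ β := by
      have : inner ℝ (b i) w = (b i : Fin d → ℝ) ⬝ᵥ Matrix.mulVec (covMatrix D) β := by
        simp [w, PiLp.inner_apply, dotProduct, mul_comm]
      rw [this, Matrix.dotProduct_mulVec, ← Matrix.mulVec_transpose]
      congr 2
    rw [h2, h1]
    simp [v, PiLp.inner_apply, dotProduct, Finset.mul_sum, mul_comm, mul_left_comm]
    rfl
  have hle : ∀ i, lambdaMin D ≤ hA.eigenvalues i := fun i =>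
    ciInf_le (Set.finite_range _).bddBelow i
  have hv : ∑ k, β k ^ 2 = ∑ i, inner ℝ (b i) v ^ 2 := by
    have h1 := b.sum_sq_norm_inner_right v
    simp only [Real.norm_eq_abs, sq_abs] at h1
    rw [h1, EuclideanSpace.norm_sq_eq]
    simp [v]
  rw [hw, ← b.sum_inner_mul_inner v w, hv, Finset.mul_sum]
  refine Finset.sum_le_sum fun i _ => ?_
  rw [hbw, real_inner_comm]
  nlinarith [mul_le_mul_of_nonneg_right (hle i) (sq_nonneg (inner ℝ v (b i)))]

theorem lambdaMin_le_diag (D : Measure ((Fin d → ℝ) × ℝ)) (k : Fin d) :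
    lambdaMin D ≤ ∫ q, q.1 k ^ 2 ∂D := by
  have := lambdaMin_mul_le D (Pi.single k 1)
  simp only [Pi.single_apply, ite_pow, one_pow, ne_eq, OfNat.ofNat_ne_zero, not_false_eq_true,
    zero_pow, Finset.sum_ite_eq', Finset.mem_univ, if_true, mul_one, ite_mul, one_mul, zero_mul,
    mul_ite, mul_zero] at this
  simpa [covMatrix, sq] using this

/-- Cauchy–Schwarz for the Frobenius inner product with `β βᵀ`, whose Frobenius norm is `‖β‖₂ ^ 2`.
-/
theorem abs_quadratic_dev_le (D : Measure ((Fin d → ℝ) × ℝ)) (z : Fin m → (Fin d → ℝ) × ℝ)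
    (β : Fin d → ℝ) : |∑ k, ∑ l, β k * β l * dev D (fun q => q.1 k * q.1 l) z|
      ≤ covDev D z * ∑ k, β k ^ 2 := by
  have h0 : 0 ≤ ∑ k, β k ^ 2 := Finset.sum_nonneg fun _ _ => sq_nonneg _
  have hc : 0 ≤ covDev D z := norm_nonneg _
  refine abs_le_of_sq_le_sq ?_ (mul_nonneg hc h0)
  rw [mul_pow, covDev_sq, ← Fintype.sum_prod_type'
    (f := fun k l => β k * β l * dev D (fun q => q.1 k * q.1 l) z)]
  refine (Finset.sum_mul_sq_le_sq_mul_sq Finset.univ (fun p : Fin d × Fin d => β p.1 * β p.2)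
    (fun p => dev D (fun q => q.1 p.1 * q.1 p.2) z)).trans (le_of_eq ?_)
  rw [mul_comm]
  congr 1
  simp_rw [mul_pow]
  rw [sq, Finset.sum_mul_sum, Fintype.sum_prod_type]

theorem norm_predVec_linPred_sq (D : Measure ((Fin d → ℝ) × ℝ)) (z : Fin m → (Fin d → ℝ) × ℝ)
    (β : Fin d → ℝ) : ‖predVec z (linPred β)‖ ^ 2 = ∑ k, ∑ l, β k * β l * covMatrix D k l
      - ∑ k, ∑ l, β k * β l * dev D (fun q => q.1 k * q.1 l) z := by
  have e : ∀ k l, β k * β l * covMatrix D k l - β k * β l * dev D (fun q => q.1 k * q.1 l) z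
      = (∑ j, β k * (z j).1 k * (β l * (z j).1 l)) / m := by
    intro k l
    simp only [covMatrix, dev, avg, Matrix.of_apply]
    rw [← mul_sub, sub_sub_cancel, ← mul_div_assoc, Finset.mul_sum]
    congr 1
    exact Finset.sum_congr rfl fun j _ => by ring
  rw [norm_predVec_sq, ← Finset.sum_sub_distrib]
  simp_rw [← Finset.sum_sub_distrib, e, ← Finset.sum_div]
  congr 1
  simp_rw [linPred, sq, Finset.sum_mul_sum]
  rw [Finset.sum_comm]
  exact Finset.sum_congr rfl fun k _ => Finset.sum_comm

theorem sum_abs_le_coeffBound {lam : ℝ} (hlam : 0 < lam) (hY : 0 ≤ Y) {β : Fin d → ℝ}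
    (h : lam * ∑ k, β k ^ 2 ≤ 2 * Y ^ 2) : ∑ k, |β k| ≤ coeffBound d Y lam := by
  have h1 : (∑ k, |β k|) ^ 2 ≤ d * ∑ k, β k ^ 2 := by
    have := sq_sum_le_card_mul_sum_sq (s := Finset.univ) (f := fun k => |β k|)
    simpa using this
  have h2 : coeffBound d Y lam ^ 2 = d * (2 * Y ^ 2 / lam) := by
    rw [coeffBound, div_pow, mul_pow, Real.sq_sqrt hlam.le, Real.sq_sqrt (by positivity)]
    ring
  refine (pow_le_pow_iff_left₀ (Finset.sum_nonneg fun _ _ => abs_nonneg _)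
    (by unfold coeffBound; positivity) two_ne_zero).1 ?_
  rw [h2]
  refine h1.trans ?_
  gcongr
  rw [le_div_iff₀ hlam]
  linarith

/-- The coefficients of least squares predictors are bounded on a dataset whose second moment
matrix is close to its mean. -/
theorem sum_abs_le_of_norm_predVec_le (hlam : 0 < lambdaMin D) (hY : 0 ≤ Y) (hm : 0 < m)
    {z : Fin m → (Fin d → ℝ) × ℝ} (hz : ∀ j, z j ∈ box d X Y R)
    (hcov : covDev D z ≤ lambdaMin D / 2) {β : Fin d → ℝ}
    (hβ : ‖predVec z (linPred β)‖ ≤ ‖labelVec z‖) : ∑ k, |β k| ≤ coeffBound d Y (lambdaMin D) := by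
  have hm' : (0 : ℝ) < m := by exact_mod_cast hm
  have h0 : 0 ≤ ∑ k, β k ^ 2 := Finset.sum_nonneg fun _ _ => sq_nonneg _
  have h1 := norm_predVec_linPred_sq D z β
  have h2 := (abs_le.1 (abs_quadratic_dev_le D z β)).2
  have h3 := lambdaMin_mul_le D β
  have h4 := mul_le_mul_of_nonneg_right hcov h0
  have h5 : ‖labelVec z‖ ^ 2 ≤ Y ^ 2 := by
    rw [norm_labelVec_sq, div_le_iff₀ hm']
    calc ∑ j, (z j).2 ^ 2 ≤ ∑ _j : Fin m, Y ^ 2 := Finset.sum_le_sum fun j _ => by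
          rw [← sq_abs]; exact pow_le_pow_left₀ (abs_nonneg _) (hz j).2.1 2
      _ = Y ^ 2 * m := by simp [mul_comm]
  have h6 := pow_le_pow_left₀ (norm_nonneg _) hβ 2
  -- `λ ‖β‖² - (λ / 2) ‖β‖² ≤ ‖predVec z (linPred β)‖² ≤ Y ^ 2`.
  exact sum_abs_le_coeffBound hlam hY (by nlinarith)

/-- The deviation is at most `λ / 2`, and `λ` is at most the second moment of each feature; this
produces the factor `3 / 2`. -/
theorem norm_predVec_feature_sq_le (hcov : covDev D (z : Fin m → (Fin d → ℝ) × ℝ) ≤ lambdaMin D / 2)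
    (k : Fin d) : ‖predVec z fun x => x k‖ ^ 2 ≤ 3 / 2 * ∫ q, q.1 k ^ 2 ∂D := by
  have h1 : (∑ j, (z j).1 k ^ 2) / m
      = ∫ q, q.1 k ^ 2 ∂D - dev D (fun q => q.1 k * q.1 k) z := by
    simp only [dev, avg, sq, sub_sub_cancel]
  have h2 : |dev D (fun q => q.1 k * q.1 k) z| ≤ covDev D z := by
    refine abs_le_of_sq_le_sq ?_ (norm_nonneg _)
    rw [covDev_sq]
    exact Finset.single_le_sum
      (f := fun p : Fin d × Fin d => dev D (fun q => q.1 p.1 * q.1 p.2) z ^ 2)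
      (fun _ _ => sq_nonneg _) (Finset.mem_univ (k, k))
  rw [norm_predVec_sq, h1]
  linarith [(abs_le.1 h2).1, lambdaMin_le_diag D k]

theorem IsBoundedLaw.mse_smul (hD : IsBoundedLaw D X Y R) (β : Fin d → ℝ) (c : ℝ) :
    mse D (linPred (c • β)) = c ^ 2 * ∑ k, ∑ l, β k * β l * covMatrix D k l
      - 2 * c * ∑ k, β k * ∫ q, q.1 k * q.2 ∂D + ∫ q, q.2 ^ 2 ∂D := by
  have h1 : ∀ k l, Integrable (fun q : (Fin d → ℝ) × ℝ =>
      (c • β) k * (c • β) l * (q.1 k * q.1 l)) D := fun k l => (hD.integrable_mul k l).const_mul _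
  have h2 : ∀ k, Integrable (fun q : (Fin d → ℝ) × ℝ => 2 * (c • β) k * (q.1 k * q.2)) D :=
    fun k => (hD.integrable_mul_label k).const_mul _
  have h1' : ∀ k, Integrable (fun q : (Fin d → ℝ) × ℝ =>
      ∑ l, (c • β) k * (c • β) l * (q.1 k * q.1 l)) D :=
    fun k => integrable_finsetSum Finset.univ fun l _ => h1 k l
  have h1'' : Integrable (fun q : (Fin d → ℝ) × ℝ =>
      ∑ k, ∑ l, (c • β) k * (c • β) l * (q.1 k * q.1 l)) D :=
    integrable_finsetSum Finset.univ fun k _ => h1' k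
  have h2' : Integrable (fun q : (Fin d → ℝ) × ℝ => ∑ k, 2 * (c • β) k * (q.1 k * q.2)) D :=
    integrable_finsetSum Finset.univ fun k _ => h2 k
  have h3 : Integrable (fun q : (Fin d → ℝ) × ℝ => ∑ k, ∑ l, (c • β) k * (c • β) l *
    (q.1 k * q.1 l) - ∑ k, 2 * (c • β) k * (q.1 k * q.2)) D := h1''.sub h2'
  have e1 : ∀ k l, ∫ q, (c • β) k * (c • β) l * (q.1 k * q.1 l) ∂D
      = c ^ 2 * (β k * β l * covMatrix D k l) := fun k l => by
    rw [integral_const_mul]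
    simp only [covMatrix, Matrix.of_apply, Pi.smul_apply, smul_eq_mul]
    ring
  have e2 : ∀ k, ∫ q, 2 * (c • β) k * (q.1 k * q.2) ∂D
      = 2 * c * (β k * ∫ q, q.1 k * q.2 ∂D) := fun k => by
    rw [integral_const_mul]
    simp only [Pi.smul_apply, smul_eq_mul]
    ring
  unfold mse
  simp_rw [sq_linPred_sub]
  rw [integral_add h3 hD.integrable_label_sq, integral_sub h1'' h2',
    integral_finsetSum _ fun k _ => h1' k, integral_finsetSum _ fun k _ => h2 k,
    Finset.sum_congr rfl fun k _ => integral_finsetSum Finset.univ fun l _ => h1 k l]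
  simp_rw [e1, e2, ← Finset.mul_sum]

theorem mse_linPred_zero (D : Measure ((Fin d → ℝ) × ℝ)) :
    mse D (linPred 0) = ∫ q, q.2 ^ 2 ∂D := by
  simp [mse, linPred]

theorem IsBoundedLaw.integral_label_sq_le (hD : IsBoundedLaw D X Y R) :
    ∫ q, q.2 ^ 2 ∂D ≤ Y ^ 2 :=
  have := hD.prob
  (le_abs_self _).trans (abs_integral_le_of_abs_le_on hD.ae_mem fun _ hq =>
    abs_label_sq_le_of_mem_box hq)

/-- The coefficients of the benchmark satisfy the bound for the learned coefficients. -/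
theorem IsBoundedLaw.sum_abs_le_of_isOptimalLinear (hD : IsBoundedLaw D X Y R)
    (hlam : 0 < lambdaMin D) (hY : 0 ≤ Y) {A : ℝ} {β : Fin d → ℝ} (hβ : IsOptimalLinear D A β) :
    ∑ k, |β k| ≤ coeffBound d Y (lambdaMin D) := by
  have h1 := hβ.2 ((1 / 2 : ℝ) • β) (by
    have : ∑ k, |((1 / 2 : ℝ) • β) k| = 1 / 2 * ∑ k, |β k| := by
      rw [Finset.mul_sum]
      exact Finset.sum_congr rfl fun k _ => by simp [abs_mul]
    rw [this]
    have h0 : 0 ≤ ∑ k, |β k| := Finset.sum_nonneg fun _ _ => abs_nonneg _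
    linarith [hβ.1])
  have h2 := hD.mse_smul β 1
  rw [one_smul] at h2
  rw [h2, hD.mse_smul] at h1
  -- Write the risk of `c • β` as `c ^ 2 * q - 2 * c * b + s`. Optimality against `β / 2`, which
  -- stays in the ball, gives `3 * q / 4 ≤ b`. Nonnegativity at `c = 3 / 4`, the best choice, then
  -- gives `q ≤ 16 / 9 * s ≤ 2 * Y ^ 2`.
  have h3 : 0 ≤ mse D (linPred ((3 / 4 : ℝ) • β)) := integral_nonneg fun _ => sq_nonneg _
  rw [hD.mse_smul] at h3
  have h4 := lambdaMin_mul_le D β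
  have h5 := hD.integral_label_sq_le
  exact sum_abs_le_coeffBound hlam hY (by nlinarith)

/-- Cauchy–Schwarz, read off the discriminant of the nonnegative risk of multiples of one feature.
-/
theorem IsBoundedLaw.sq_integral_mul_label_le (hD : IsBoundedLaw D X Y R) (k : Fin d) :
    (∫ q, q.1 k * q.2 ∂D) ^ 2 ≤ (∫ q, q.1 k ^ 2 ∂D) * ∫ q, q.2 ^ 2 ∂D := by
  have h : ∀ s : ℝ, 0 ≤ (∫ q, q.1 k ^ 2 ∂D) * (s * s) + (-2 * ∫ q, q.1 k * q.2 ∂D) * s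
      + ∫ q, q.2 ^ 2 ∂D := by
    intro s
    have h1 := hD.mse_smul (Pi.single k 1) s
    have h2 : 0 ≤ mse D (linPred (s • Pi.single k 1)) := integral_nonneg fun _ => sq_nonneg _
    simp only [Pi.single_apply, ite_mul, one_mul, zero_mul, mul_ite, mul_zero, mul_one,
      Finset.sum_ite_eq', Finset.mem_univ, if_true] at h1
    rw [h1] at h2
    have e : covMatrix D k k = ∫ q, q.1 k ^ 2 ∂D := by simp [covMatrix, sq]
    rw [← e]
    linarith
  have := discrim_le_zero h
  rw [discrim] at this
  nlinarith

/-- The benchmark can gain over the zero predictor at most twice its correlation with the label,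
which is at most `A * |MX| * √(𝔼 y²)`. This settles the short admissible paths. -/
theorem IsBoundedLaw.mse_zero_le (hD : IsBoundedLaw D X Y R) {MX : ℝ}
    (hMX : ∀ k, ∫ q, q.1 k ^ 2 ∂D ≤ MX ^ 2) {β : Fin d → ℝ} {A : ℝ} (hβ : ∑ k, |β k| ≤ A)
    (hlam : 0 < lambdaMin D) {η : ℝ} (hη : 0 ≤ η)
    (h : 4 * mse D (linPred 0) * (A * MX) ^ 2 ≤ η ^ 2) :
    mse D (linPred 0) ≤ mse D (linPred β) + η := by
  rw [mse_linPred_zero] at h ⊢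
  set s := ∫ q, q.2 ^ 2 ∂D
  have hs : 0 ≤ s := integral_nonneg fun _ => sq_nonneg _
  have h2 := hD.mse_smul β 1
  rw [one_smul] at h2
  have hq : 0 ≤ ∑ k, ∑ l, β k * β l * covMatrix D k l :=
    (mul_nonneg hlam.le (Finset.sum_nonneg fun _ _ => sq_nonneg _)).trans (lambdaMin_mul_le D β)
  have hk : ∀ k, |∫ q, q.1 k * q.2 ∂D| ≤ |MX| * √s := fun k => by
    refine abs_le_of_sq_le_sq ?_ (by positivity)
    rw [mul_pow, sq_abs, Real.sq_sqrt hs]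
    exact (hD.sq_integral_mul_label_le k).trans (mul_le_mul_of_nonneg_right (hMX k) hs)
  have hb : ∑ k, β k * ∫ q, q.1 k * q.2 ∂D ≤ A * (|MX| * √s) := by
    calc _ ≤ ∑ k, |β k| * (|MX| * √s) := Finset.sum_le_sum fun k _ => by
          refine (le_abs_self _).trans ?_
          rw [abs_mul]
          exact mul_le_mul_of_nonneg_left (hk k) (abs_nonneg _)
      _ = (∑ k, |β k|) * (|MX| * √s) := (Finset.sum_mul _ _ _).symm
      _ ≤ _ := mul_le_mul_of_nonneg_right hβ (by positivity)
  have hη' : 2 * (A * (|MX| * √s)) ≤ η := by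
    refine le_of_sq_le_sq ?_ hη
    calc (2 * (A * (|MX| * √s))) ^ 2 = 4 * s * (A * MX) ^ 2 := by
          rw [mul_pow, mul_pow, mul_pow, Real.sq_sqrt hs, sq_abs]; ring
      _ ≤ η ^ 2 := h
  rw [h2]
  linarith

end Law

/-! ### Size of the generalization error and of the sample -/

theorem two_mul_le_coeffBound_mul {d : ℕ} (hd : 2 ≤ d) {X Y lam : ℝ} (hlam : 0 < lam) (hX : 0 ≤ X)
    (hY : 0 ≤ Y) (h : lam ≤ X ^ 2) : 2 * Y ≤ coeffBound d Y lam * X := by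
  have h1 : √lam ≤ X := Real.sqrt_le_iff.2 ⟨hX, h⟩
  have h0 : 0 < √lam := Real.sqrt_pos.2 hlam
  have hd' : (2 : ℝ) ≤ d := by exact_mod_cast hd
  have h2 : 2 ≤ √(2 * d) := Real.le_sqrt_of_sq_le (by linarith)
  rw [coeffBound, div_mul_eq_mul_div, le_div_iff₀ h0]
  calc 2 * Y * √lam ≤ √(2 * d) * Y * X := by gcongr

theorem coeffBound_nonneg (d : ℕ) {Y lam : ℝ} (hY : 0 ≤ Y) : 0 ≤ coeffBound d Y lam := by
  unfold coeffBound; positivity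

theorem half_le_log {d : ℕ} (hd : 2 ≤ d) : 1 / 2 ≤ Real.log d := by
  have hd' : (2 : ℝ) ≤ d := by exact_mod_cast hd
  have := Real.log_le_log (by norm_num) hd'
  linarith [Real.log_two_gt_d9]

/-- The order of the generalization error. -/
theorem epsGen_le {d m : ℕ} (hd : 2 ≤ d) {X Y lam δ : ℝ} (hlam : 0 < lam) (hX : 0 ≤ X)
    (hY : 0 ≤ Y) (h : lam ≤ X ^ 2) (hδ : δ ∈ Set.Ioo (0 : ℝ) 1) :
    epsGen d m X Y lam δ ≤ 16 * (coeffBound d Y lam * X + Y) * √(1 + Real.log (1 / δ))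
      * (√d * X * Y / √lam * √(Real.log d / m)) := by
  have hl : 0 < Real.log (1 / δ) := Real.log_pos (by rw [lt_div_iff₀ hδ.1]; linarith [hδ.2])
  have hld := half_le_log hd
  have h2 := two_mul_le_coeffBound_mul hd hlam hX hY h
  set q := √d * X * Y / √lam with hq
  have hq0 : 0 ≤ q := by positivity
  have hΛ : coeffBound d Y lam * X = √2 * q := by
    rw [coeffBound, hq, Real.sqrt_mul (by norm_num)]; ring
  set σ := √(Real.log d / m)
  set ρ := √(1 + Real.log (1 / δ))
  have hσ : 0 ≤ σ := Real.sqrt_nonneg _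
  have hρ : 1 ≤ ρ := Real.one_le_sqrt.2 (by linarith)
  have h3 : √(Real.log (2 / δ) / (2 * m)) ≤ ρ * σ := by
    rw [← Real.sqrt_mul (by positivity)]
    apply Real.sqrt_le_sqrt
    have e : Real.log (2 / δ) = Real.log 2 + Real.log (1 / δ) := by
      rw [← Real.log_mul (by norm_num) (by have := hδ.1; positivity)]; ring_nf
    rw [e, ← div_div, mul_div_assoc']
    gcongr
    nlinarith [Real.log_two_lt_d9]
  have hs2 : √2 ≤ 1.42 := Real.sqrt_le_iff.2 ⟨by norm_num, by norm_num⟩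
  unfold epsGen
  rw [hΛ] at h2 ⊢
  set s := √2 * q with hs
  have hs0 : 0 ≤ s := by positivity
  have hsq : s ≤ 1.42 * q := by rw [hs]; gcongr
  -- `2 * Y ≤ s` turns one factor `s + Y` of the second term into `3 / 2 * s`; then `(8 + 3 / 2) *
  -- 1.42 = 13.49 ≤ 16`.
  calc _ ≤ 8 * (s + Y) * s * (ρ * σ) + (s + Y) * (s + s / 2) * (ρ * σ) := by
        gcongr
        · exact le_mul_of_one_le_left hσ hρ
        · rw [sq]
          gcongr
          linarith
    _ = 9.5 * (s + Y) * (ρ * σ) * s := by ring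
    _ ≤ 9.5 * (s + Y) * (ρ * σ) * (1.42 * q) := by gcongr
    _ = 13.49 * ((s + Y) * ρ * (q * σ)) := by ring
    _ ≤ 16 * ((s + Y) * ρ * (q * σ)) := by gcongr; norm_num
    _ = _ := by ring

/-- The required sample size makes the deviation of the second moment matrix small. -/
theorem covDev_threshold_le {d m : ℕ} (hd : 2 ≤ d) {RX lam δ : ℝ} (hlam : 0 < lam)
    (hδ : δ ∈ Set.Ioo (0 : ℝ) 1)
    (hm : 4 * 4 ^ 2 * RX ^ 4 * (Real.log d + Real.log (1 / δ)) / lam ^ 2 < m) :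
    RX ^ 2 / √m + 2 * RX ^ 2 * √(Real.log (1 / (δ / 2)) / (2 * m)) ≤ lam / 2 := by
  have hl : 0 < Real.log (1 / δ) := Real.log_pos (by rw [lt_div_iff₀ hδ.1]; linarith [hδ.2])
  have hld := half_le_log hd
  have hd' : (2 : ℝ) ≤ d := by exact_mod_cast hd
  have hm' : (0 : ℝ) < m := lt_of_le_of_lt (by positivity) hm
  set T := Real.log d + Real.log (1 / δ)
  have hT : 1 / 2 ≤ T := by linarith
  have e : Real.log (1 / (δ / 2)) ≤ T := by
    have : 1 / (δ / 2) = 2 * (1 / δ) := by field_simp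
    rw [this, Real.log_mul (by norm_num) (by have := hδ.1; positivity)]
    have := Real.log_le_log (by norm_num) hd'
    linarith
  have hsm : 0 < √m := Real.sqrt_pos.2 hm'
  have h1 : √(Real.log (1 / (δ / 2)) / (2 * m)) ≤ √T / √m := by
    rw [← Real.sqrt_div (by linarith)]
    apply Real.sqrt_le_sqrt
    rw [div_le_div_iff₀ (by positivity) hm']
    nlinarith
  have hsT : 1 / 2 ≤ √T := Real.le_sqrt_of_sq_le (by linarith)
  have h2 : 8 * RX ^ 2 * √T ≤ lam * √m := by
    refine le_of_sq_le_sq ?_ (by positivity)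
    rw [mul_pow, mul_pow, mul_pow, Real.sq_sqrt hm'.le, Real.sq_sqrt (by linarith)]
    rw [div_lt_iff₀ (by positivity)] at hm
    linarith
  calc _ ≤ RX ^ 2 / √m + 2 * RX ^ 2 * (√T / √m) := by gcongr
    _ = (RX ^ 2 + 2 * RX ^ 2 * √T) / √m := by ring
    -- `1 / 2 ≤ √T` bounds the numerator by `4 * RX ^ 2 * √T`, which is half of the left side of
    -- `h2`.
    _ ≤ lam / 2 := by
        rw [div_le_iff₀ hsm]
        nlinarith [sq_nonneg RX]

/-! ### Admissible path lengths -/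

theorem neg_log_one_sub_ge {p : ℝ} (hp : p ∈ Set.Ioo (0 : ℝ) 1) : p ≤ -Real.log (1 - p) := by
  have := Real.log_le_sub_one_of_pos (sub_pos.2 hp.2)
  linarith

/-- The union bound over the blocks and the features. -/
theorem IsRequiredLength.blocks_mul_le {d : ℕ} (hd : 2 ≤ d) {p δL η mse0 A MX : ℝ} {N₀ M : ℕ}
    (hp : p ∈ Set.Ioo (0 : ℝ) 1) (hδL : δL ∈ Set.Ioo (0 : ℝ) 1)
    (h : IsRequiredLength d p δL η mse0 A MX N₀ M) :
    ((N₀ / M : ℕ) : ℝ) * d * (1 - p) ^ M ≤ δL := by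
  have hN : (0 : ℝ) < N₀ := by exact_mod_cast h.one_le_length
  have hM : (0 : ℝ) < M := by exact_mod_cast h.one_le_block
  have hd' : (0 : ℝ) < d := by exact_mod_cast (by omega : 0 < d)
  have hq : 0 < 1 - p := sub_pos.2 hp.2
  have hδ := hδL.1
  have h1 := Nat.ceil_le.1 h.block
  rw [div_le_iff₀ (lt_of_lt_of_le hp.1 (neg_log_one_sub_ge hp)),
    ← Real.log_mul (by positivity) (by positivity)] at h1
  have h2 : Real.log (N₀ * d / M * (1 / δL) * (1 - p) ^ M) ≤ 0 := by
    rw [Real.log_mul (by positivity) (by positivity), Real.log_pow]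
    linarith
  have h3 := (Real.log_nonpos_iff (by positivity)).1 h2
  have h4 : (N₀ : ℝ) * d / M * (1 - p) ^ M ≤ δL := by
    have : (N₀ : ℝ) * d / M * (1 / δL) * (1 - p) ^ M = N₀ * d / M * (1 - p) ^ M / δL := by ring
    rw [this, div_le_one hδ] at h3
    exact h3
  calc _ ≤ (N₀ : ℝ) / M * d * (1 - p) ^ M := by
        gcongr
        exact Nat.cast_div_le
    _ = (N₀ : ℝ) * d / M * (1 - p) ^ M := by ring
    _ ≤ δL := h4

/-- Short paths are admissible only if the zero predictor already satisfies the guarantee. -/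
theorem IsRequiredLength.four_mul_le {d : ℕ} {p δL η mse0 A MX : ℝ} {N₀ M : ℕ}
    (h : IsRequiredLength d p δL η mse0 A MX N₀ M) (hη : 0 < η) (h0 : 0 ≤ mse0)
    (hNM : N₀ < M * M) : 4 * mse0 * (A * MX) ^ 2 ≤ η ^ 2 := by
  have h1 := Nat.ceil_le.1 h.length
  rw [div_le_iff₀ (by positivity)] at h1
  have hM : (1 : ℝ) ≤ M := by exact_mod_cast h.one_le_block
  have h2 : (N₀ : ℝ) ≤ M ^ 2 := by rw [sq]; exact_mod_cast hNM.le
  have h3 : 8 * (M : ℝ) ^ 2 * mse0 * (A * MX) ^ 2 ≤ M ^ 2 * η ^ 2 :=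
    h1.trans (mul_le_mul_of_nonneg_right h2 (sq_nonneg _))
  have h4 : (M : ℝ) ^ 2 * (8 * mse0 * (A * MX) ^ 2) ≤ M ^ 2 * η ^ 2 := by linarith
  have h5 := le_of_mul_le_mul_left h4 (by positivity)
  have : 0 ≤ mse0 * (A * MX) ^ 2 := by positivity
  linarith

/-- On admissible paths the loss of a block argument is at most `η`. -/
theorem IsRequiredLength.block_loss_le {d : ℕ} {p δL η mse0 A MX : ℝ} {N₀ n : ℕ}
    (h : IsRequiredLength d p δL η mse0 A MX N₀ (n + 1)) (hη : 0 < η)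
    (hNM : (n + 1) * (n + 1) ≤ N₀) {e : ℝ} (he : e ≤ 4 / 3 * mse0) (he0 : 0 ≤ e) :
    2 * A * (√(3 / 2) * |MX|) * √(n * (e / (N₀ / (n + 1) : ℕ))) ≤ η := by
  have h1 := Nat.ceil_le.1 h.length
  rw [div_le_iff₀ (by positivity)] at h1
  set B := N₀ / (n + 1) with hB
  have hBM : n + 1 ≤ B := (Nat.le_div_iff_mul_le (by omega)).2 hNM
  -- Rounding down to whole blocks costs nothing: a block has only `n` edges but length `n + 1`, and
  -- this slack absorbs the remainder, which is at most `n`, because `n + 1 ≤ B`.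
  have hnat : N₀ * n ≤ B * (n + 1) ^ 2 := by
    have e1 : N₀ < (B + 1) * (n + 1) := by
      rw [hB, mul_comm]; exact Nat.lt_mul_div_succ N₀ (by omega)
    have e2 : N₀ ≤ B * (n + 1) + n := by rw [add_mul] at e1; omega
    have e3 : n * n ≤ B * (n + 1) := Nat.mul_le_mul (by omega) (by omega)
    nlinarith [Nat.mul_le_mul_right n e2]
  have hreal : (N₀ : ℝ) * n ≤ B * ((n + 1 : ℕ) : ℝ) ^ 2 := by exact_mod_cast hnat
  have hB0 : (0 : ℝ) < B := by exact_mod_cast (by omega : 0 < B)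
  have hM0 : (0 : ℝ) < ((n + 1 : ℕ) : ℝ) ^ 2 := by positivity
  refine le_of_sq_le_sq ?_ hη.le
  have hexp : (2 * A * (√(3 / 2) * |MX|) * √(n * (e / B))) ^ 2
      = 6 * (A * MX) ^ 2 * n * e / B := by
    rw [mul_pow, mul_pow, mul_pow, mul_pow, Real.sq_sqrt (by norm_num),
      Real.sq_sqrt (by positivity), sq_abs]
    ring
  rw [hexp, div_le_iff₀ hB0]
  -- The constant `8` in the required length is `4 * (3 / 2) * (4 / 3)`: the square of the factor
  -- `2`, the loss on feature norms and the loss on the zero predictor's error.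
  have h2 : 6 * (A * MX) ^ 2 * n * e ≤ 6 * (A * MX) ^ 2 * n * (4 / 3 * mse0) := by gcongr
  refine h2.trans ?_
  have h3 : ((n + 1 : ℕ) : ℝ) ^ 2 * (6 * (A * MX) ^ 2 * n * (4 / 3 * mse0))
      ≤ ((n + 1 : ℕ) : ℝ) ^ 2 * (η ^ 2 * B) := by
    have h4 := mul_le_mul_of_nonneg_right h1 (Nat.cast_nonneg (α := ℝ) n)
    have h5 := mul_le_mul_of_nonneg_right hreal (sq_nonneg η)
    linarith
  exact le_of_mul_le_mul_left h3 hM0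

/-- Admissible path lengths exist, and their order. -/
theorem exists_isRequiredLength {δL : ℝ} (hδL : δL ∈ Set.Ioo (0 : ℝ) 1) (W : ℝ) :
    ∃ K : ℝ, 0 < K ∧ ∀ (d : ℕ), 2 ≤ d → ∀ mse0 A MX : ℝ, mse0 * (A * MX) ^ 2 ≤ W →
      ∀ p ∈ Set.Ioo (0 : ℝ) 1, ∀ η : ℝ, 0 < η →
        ∃ N₀ M : ℕ, IsRequiredLength d p δL η mse0 A MX N₀ M ∧ (η ≤ 1 →
          (N₀ : ℝ) ≤ K * ((Real.log d + Real.log (1 / (p * η))) ^ 2 / (p ^ 2 * η ^ 2))) := by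
  have hδ := hδL.1
  set w := |W| with hw
  have hw0 : 0 ≤ w := abs_nonneg _
  set c := Real.log (2 * (8 * w + 2) / δL) with hc
  have hc0 : 0 ≤ c := Real.log_nonneg (by rw [le_div_iff₀ hδ]; linarith [hδL.2])
  set a := 4 * c + 6 with ha
  refine ⟨8 * w * a ^ 2 + 8, by positivity, fun d hd mse0 A MX hW p hp η hη => ?_⟩
  have hp0 := hp.1
  have hd0 : (0 : ℝ) < d := by exact_mod_cast (by omega : 0 < d)
  have hld := half_le_log hd
  set η' := min η 1 with hη'
  have hη'0 : 0 < η' := lt_min hη one_pos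
  have hlp : 0 < Real.log (1 / p) := Real.log_pos (by rw [lt_div_iff₀ hp0]; linarith [hp.2])
  have hlη : 0 ≤ Real.log (1 / η') := Real.log_nonneg (by
    rw [le_div_iff₀ hη'0, one_mul]; exact min_le_right _ _)
  set Q := c + Real.log (1 / p) + 2 * Real.log (1 / η') + Real.log d with hQ
  have hQ0 : 0 < Q := by positivity
  -- The two conditions are circular, since `N₀` grows like `M ^ 2` and `M` must exceed `log (N₀ /
  -- M) / p`. Half of `M * p` pays for `Q`, the other half for `log M`.
  set M := ⌈2 * Q / p⌉₊ with hM
  have hMp : 0 < M := Nat.ceil_pos.2 (by positivity)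
  have hM1 : (1 : ℝ) ≤ M := by exact_mod_cast hMp
  have hM0 : (0 : ℝ) < M := by positivity
  have hMQ : 2 * Q ≤ M * p := by
    rw [← div_le_iff₀ hp0]; exact Nat.le_ceil _
  have hMle : (M : ℝ) ≤ 2 * Q / p + 1 := (Nat.ceil_lt_add_one (by positivity)).le
  set N₀ := ⌈8 * (M : ℝ) ^ 2 * w / η' ^ 2⌉₊ + 1 with hN
  have hN0 : (0 : ℝ) < N₀ := by simp only [hN]; positivity
  have hNle : (N₀ : ℝ) ≤ 8 * (M : ℝ) ^ 2 * w / η' ^ 2 + 2 := by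
    have := (Nat.ceil_lt_add_one (show 0 ≤ 8 * (M : ℝ) ^ 2 * w / η' ^ 2 by positivity)).le
    simp only [hN]; push_cast; linarith
  have hη'1 : η' ^ 2 ≤ 1 := pow_le_one₀ hη'0.le (min_le_right _ _)
  refine ⟨N₀, M, ⟨by omega, hMp, ?_, ?_⟩, fun hη1 => ?_⟩
  · rw [Nat.ceil_le, div_le_iff₀ (lt_of_lt_of_le hp0 (neg_log_one_sub_ge hp))]
    have h1 : (N₀ : ℝ) * d / M ≤ (8 * w + 2) * M * (1 / η') ^ 2 * d := by
      rw [div_le_iff₀ hM0]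
      have : (N₀ : ℝ) ≤ (8 * w + 2) * M * (1 / η') ^ 2 * M := by
        calc (N₀ : ℝ) ≤ 8 * (M : ℝ) ^ 2 * w / η' ^ 2 + 2 := hNle
          _ ≤ 8 * (M : ℝ) ^ 2 * w / η' ^ 2 + 2 * M ^ 2 / η' ^ 2 := by
              gcongr
              rw [le_div_iff₀ (by positivity)]
              nlinarith
          _ = _ := by field_simp
      nlinarith
    have h2 : Real.log (N₀ * d / M) ≤ Real.log (8 * w + 2) + Real.log M + 2 * Real.log (1 / η')
        + Real.log d := by
      refine (Real.log_le_log (by positivity) h1).trans (le_of_eq ?_)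
      rw [Real.log_mul (by positivity) (by positivity), Real.log_mul (by positivity) (by positivity),
        Real.log_mul (by positivity) (by positivity), Real.log_pow]
      norm_num
    -- `log u ≤ u - 1` at `u = M * p / 2`.
    have h3 : Real.log M ≤ M * p / 2 + Real.log 2 + Real.log (1 / p) := by
      have : (M : ℝ) = M * p / 2 * 2 * (1 / p) := by field_simp
      have h4 := Real.log_le_sub_one_of_pos (show 0 < M * p / 2 by positivity)
      rw [this, Real.log_mul (by positivity) (by positivity),
        Real.log_mul (by positivity) (by positivity), ← this]
      linarith
    have h4 : c = Real.log 2 + Real.log (8 * w + 2) + Real.log (1 / δL) := by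
      rw [hc, ← Real.log_mul (by positivity) (by positivity),
        ← Real.log_mul (by positivity) (by positivity)]
      congr 1; ring
    have h5 : (M : ℝ) * p ≤ M * -Real.log (1 - p) := by
      gcongr; exact neg_log_one_sub_ge hp
    linarith
  · refine (Nat.ceil_le_ceil ?_).trans (Nat.le_succ _)
    have h1 : mse0 * (A * MX) ^ 2 ≤ w := hW.trans (le_abs_self _)
    calc 8 * (M : ℝ) ^ 2 * mse0 * (A * MX) ^ 2 / η ^ 2
        = 8 * (M : ℝ) ^ 2 * (mse0 * (A * MX) ^ 2) / η ^ 2 := by ring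
      _ ≤ 8 * (M : ℝ) ^ 2 * w / η ^ 2 := by gcongr
      _ ≤ 8 * (M : ℝ) ^ 2 * w / η' ^ 2 := by gcongr; exact min_le_left _ _
  · have hηη : η' = η := min_eq_left hη1
    rw [hηη] at hNle hQ hlη hη'1
    set T := Real.log d + Real.log (1 / (p * η)) with hT
    have hTe : T = Real.log d + Real.log (1 / p) + Real.log (1 / η) := by
      rw [hT, ← one_div_mul_one_div, Real.log_mul (by positivity) (by positivity), add_assoc]
    have hT2 : 1 / 2 ≤ T := by linarith
    -- `1 / 2 ≤ T` absorbs constants: `c ≤ 2 * c * T` here, and the rounding of `M` in the next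
    -- step, which is why `a = 4 * c + 6`.
    have hQT : Q ≤ (2 * c + 2) * T := by nlinarith
    have hMT : (M : ℝ) ≤ a * T / p := by
      refine hMle.trans ?_
      rw [div_add_one hp0.ne', div_le_div_iff_of_pos_right hp0]
      nlinarith [hp.2]
    calc (N₀ : ℝ) ≤ 8 * (M : ℝ) ^ 2 * w / η ^ 2 + 2 := hNle
      _ ≤ 8 * (a * T / p) ^ 2 * w / η ^ 2 + 8 * (T ^ 2 / (p ^ 2 * η ^ 2)) := by
          gcongr
          have h1 : T ^ 2 ≤ T ^ 2 / (p ^ 2 * η ^ 2) := by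
            rw [le_div_iff₀ (by positivity)]
            have h2 : p ^ 2 * η ^ 2 ≤ 1 :=
              mul_le_one₀ (pow_le_one₀ hp0.le hp.2.le) (by positivity) hη'1
            exact mul_le_of_le_one_right (sq_nonneg T) h2
          have h3 : (1 / 2) ^ 2 ≤ T ^ 2 := pow_le_pow_left₀ (by norm_num) hT2 2
          linarith
      _ = _ := by field_simp

/-! ### Good samples and the guarantee on the true risk -/

theorem linPred_zero (d : ℕ) : linPred (0 : Fin d → ℝ) = fun _ => 0 := by
  ext x; simp [linPred]

/-- The properties of a dataset from which the guarantee follows: the second moment matrix is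
accurate, the empirical risk is uniformly accurate for the learned predictors, and it is not much
larger than the risk for the benchmark `β` and for the zero predictor. -/
structure IsGoodSample {d m : ℕ} (D : Measure ((Fin d → ℝ) × ℝ)) (X Y R Λ ε t : ℝ)
    (β : Fin d → ℝ) (z : Fin m → (Fin d → ℝ) × ℝ) : Prop where
  mem_box : ∀ j, z j ∈ box d X Y R
  cov : covDev D z ≤ lambdaMin D / 2
  gap : supGap D Λ z ≤ ε
  benchmark : empMSE z (linPred β) ≤ mse D (linPred β) + ε
  zero : empMSE z (linPred 0) ≤ mse D (linPred 0) + t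

theorem continuous_empMSE_linPred {d m : ℕ} (β : Fin d → ℝ) :
    Continuous fun z : Fin m → (Fin d → ℝ) × ℝ => empMSE z (linPred β) := by
  unfold empMSE linPred
  fun_prop

theorem IsBoundedLaw.measurableSet_isGoodSample {d m : ℕ} {D : Measure ((Fin d → ℝ) × ℝ)}
    {X Y R : ℝ} (hD : IsBoundedLaw D X Y R) (Λ ε t : ℝ) (β : Fin d → ℝ) :
    MeasurableSet {z : Fin m → (Fin d → ℝ) × ℝ | IsGoodSample D X Y R Λ ε t β z} := by
  have e : {z : Fin m → (Fin d → ℝ) × ℝ | IsGoodSample D X Y R Λ ε t β z}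
      = (⋂ j, (fun z => z j) ⁻¹' box d X Y R) ∩ ({z | covDev D z ≤ lambdaMin D / 2}
        ∩ ({z | supGap D Λ z ≤ ε} ∩ ({z | empMSE z (linPred β) ≤ mse D (linPred β) + ε}
        ∩ {z | empMSE z (linPred 0) ≤ mse D (linPred 0) + t}))) := by
    ext z
    simp only [Set.mem_inter_iff, Set.mem_iInter, Set.mem_preimage, Set.mem_ofPred_eq]
    exact ⟨fun h => ⟨h.1, h.2, h.3, h.4, h.5⟩, fun h => ⟨h.1, h.2.1, h.2.2.1, h.2.2.2.1, h.2.2.2.2⟩⟩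
  rw [e]
  refine (MeasurableSet.iInter fun j => measurable_pi_apply j (measurableSet_box d X Y R)).inter
    (IsClosed.measurableSet ?_)
  exact (isClosed_le (continuous_covDev D) continuous_const).inter
    ((isClosed_le (hD.continuous_supGap Λ) continuous_const).inter
    ((isClosed_le (continuous_empMSE_linPred β) continuous_const).inter
    (isClosed_le (continuous_empMSE_linPred 0) continuous_const)))

/-- A sample of the required size is good with high probability. -/
theorem IsBoundedLaw.le_measureReal_isGoodSample {d m : ℕ} (hd : 2 ≤ d)
    {D : Measure ((Fin d → ℝ) × ℝ)} {X Y RX : ℝ} (hD : IsBoundedLaw D X Y (RX ^ 2))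
    (hX : 0 ≤ X) (hY : 0 ≤ Y) (hR : 0 < RX ^ 2) (hlam : 0 < lambdaMin D)
    {A : ℝ} {β : Fin d → ℝ} (hβ : IsOptimalLinear D A β) {δ : ℝ} (hδ : δ ∈ Set.Ioo (0 : ℝ) 1)
    (hm : 4 * 4 ^ 2 * RX ^ 4 * (Real.log d + Real.log (1 / δ)) / lambdaMin D ^ 2 < m) :
    1 - 2 * δ ≤ (Measure.pi fun _ => D).real {z : Fin m → (Fin d → ℝ) × ℝ |
      IsGoodSample D X Y (RX ^ 2) (coeffBound d Y (lambdaMin D))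
        (epsGen d m X Y (lambdaMin D) δ) (Y ^ 2 * √(Real.log (2 / δ) / (2 * m))) β z} := by
  have := hD.prob
  have hl : 0 < Real.log (1 / δ) := Real.log_pos (by rw [lt_div_iff₀ hδ.1]; linarith [hδ.2])
  have hld := half_le_log hd
  have hm0 : 0 < m := by
    have : (0 : ℝ) < m := lt_of_le_of_lt (by positivity) hm
    exact_mod_cast this
  have hδ2 : δ / 2 ∈ Set.Ioo (0 : ℝ) 1 := ⟨by linarith [hδ.1], by linarith [hδ.2]⟩
  have e2 : 1 / (δ / 2) = 2 / δ := by field_simp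
  set Λ := coeffBound d Y (lambdaMin D) with hΛdef
  have hΛ : 0 ≤ Λ := coeffBound_nonneg d hY
  have b1 := hD.measureReal_covDev_gt_le hm0 hR hδ2
  have b2 := hD.measureReal_supGap_gt_le hd hm0 hX hY hΛ hδ2
  have b3 := hD.measureReal_empMSE_gt_le hm0 hX (hD.sum_abs_le_of_isOptimalLinear hlam hY hβ) hδ2
  have b4 := hD.measureReal_empMSE_gt_le (Λ := 0) (β := 0) hm0 hX (by simp) hδ2
  have thr := covDev_threshold_le hd hlam hδ hm
  rw [e2] at b1 b2 b3 b4 thr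
  rw [zero_mul, zero_add] at b4
  have b0 : (Measure.pi fun _ : Fin m => D).real {z | ∀ j, z j ∈ box d X Y (RX ^ 2)}ᶜ = 0 := by
    rw [measureReal_def, mem_ae_iff.1 (ae_pi_mem hD.ae_mem m)]
    rfl
  have hε : (Λ * X + Y) ^ 2 * √(Real.log (2 / δ) / (2 * m)) ≤ epsGen d m X Y (lambdaMin D) δ := by
    unfold epsGen
    have : 0 ≤ 8 * (Λ * X + Y) * (Λ * X) * √(Real.log d / m) := by positivity
    linarith
  have hmeas := hD.measurableSet_isGoodSample (m := m) Λ (epsGen d m X Y (lambdaMin D) δ)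
    (Y ^ 2 * √(Real.log (2 / δ) / (2 * m))) β
  have hc := probReal_compl_eq_one_sub (μ := Measure.pi fun _ : Fin m => D) hmeas
  -- Four bad events of probability at most `δ / 2` each, besides a null set, give `2 * δ`; the
  -- halving is the source of `log (2 / δ)`.
  have hsub : (Measure.pi fun _ : Fin m => D).real {z : Fin m → (Fin d → ℝ) × ℝ |
      IsGoodSample D X Y (RX ^ 2) Λ (epsGen d m X Y (lambdaMin D) δ)
        (Y ^ 2 * √(Real.log (2 / δ) / (2 * m))) β z}ᶜ
      ≤ 0 + (δ / 2 + (δ / 2 + (δ / 2 + δ / 2))) := by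
    refine le_trans (measureReal_mono ?_ (measure_ne_top _ _)) <|
      (measureReal_union_le _ _).trans <| add_le_add b0.le <|
      (measureReal_union_le _ _).trans <| add_le_add b1 <|
      (measureReal_union_le _ _).trans <| add_le_add b2 <|
      (measureReal_union_le _ _).trans <| add_le_add b3 b4
    intro z hz
    by_contra hcon
    simp only [Set.mem_union, not_or, Set.mem_compl_iff, not_not, Set.mem_ofPred_eq, not_lt] at hcon hz
    obtain ⟨h0, h1, h2, h3, h4⟩ := hcon
    exact hz ⟨h0, h1.trans thr, h2, h3.trans (by linarith), h4⟩
  linarith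

/-- The guarantee for a good sample and a path whose blocks observe all features. -/
theorem IsGoodSample.exists_forall_mse_le {d m : ℕ} {D : Measure ((Fin d → ℝ) × ℝ)}
    {X Y R ε t : ℝ} {β : Fin d → ℝ} {z : Fin m → (Fin d → ℝ) × ℝ}
    (hz : IsGoodSample D X Y R (coeffBound d Y (lambdaMin D)) ε t β z)
    (hD : IsBoundedLaw D X Y R) (hm : 0 < m) (hY : 0 ≤ Y) (hlam : 0 < lambdaMin D)
    (ht : 4 * t ≤ ε) (ht0 : 0 ≤ t) {A MX : ℝ} (hβ : ∑ k, |β k| ≤ A)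
    (hMX : ∀ k, ∫ q, q.1 k ^ 2 ∂D ≤ MX ^ 2) {p δL η : ℝ} (hη : 0 < η) {N₀ M : ℕ}
    (hN : IsRequiredLength d p δL η (mse D fun _ => 0) A MX N₀ M)
    {V : Type*} [Fintype V] {G : Digraph V} (hG : IsDAG G) {L : ℕ} (hL : N₀ ≤ L) {P : Fin L → V}
    (hP : IsPath G P) {S : V → Set (Fin d)}
    (hcov : ∀ b < N₀ / M, ∀ k, ∃ t : Fin L,
      b * M ≤ t ∧ (t : ℕ) + 1 ≤ b * M + M ∧ k ∈ S (P t))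
    {f : V → (Fin d → ℝ) → ℝ} (hf : IsLeastSquaresFit (empMSE z) G S f) :
    ∃ j : Fin L, (j : ℕ) + 1 ≤ N₀ ∧ ∀ k : Fin L, j ≤ k →
      mse D (f (P k)) ≤ mse D (linPred β) + η + 2 * ε := by
  rw [← linPred_zero] at hN
  have hN1 := hN.one_le_length
  have hs0 : 0 ≤ mse D (linPred 0) := integral_nonneg fun _ => sq_nonneg _
  have hb0 : 0 ≤ mse D (linPred β) := integral_nonneg fun _ => sq_nonneg _
  have hgap : ∀ v, mse D (f v) ≤ empMSE z (f v) + ε := fun v => by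
    obtain ⟨γ, hγ⟩ := exists_eq_linPred hG (fun i => (hf i).1) v
    have h1 := hf.norm_predVec_le v
    rw [hγ] at h1 ⊢
    have h2 := hD.dev_le_supGap
      (sum_abs_le_of_norm_predVec_le hlam hY hm hz.mem_box hz.cov h1) z
    rw [← mse_sub_empMSE] at h2
    linarith [hz.gap]
  have hzero := hz.zero
  by_cases hshort : N₀ < M * M
  · have h1 := hD.mse_zero_le hMX hβ hlam hη.le (hN.four_mul_le hη hs0 hshort)
    exact ⟨⟨0, by omega⟩, by simpa using hN1, fun k _ => by
      linarith [hgap (P k), hf.empMSE_le_zero (P k)]⟩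
  by_cases hbig : 4 / 3 * mse D (linPred 0) < empMSE z (linPred 0)
  -- The empirical error exceeds the true error by at most `t`, so the true one is below `3 * t` and
  -- the empirical one below `4 * t ≤ ε`.
  · exact ⟨⟨0, by omega⟩, by simpa using hN1, fun k _ => by
      linarith [hgap (P k), hf.empMSE_le_zero (P k)]⟩
  obtain ⟨n, rfl⟩ : ∃ n, M = n + 1 := ⟨M - 1, by have := hN.one_le_block; omega⟩
  have hB : 0 < N₀ / (n + 1) :=
    lt_of_lt_of_le (Nat.succ_pos n) ((Nat.le_div_iff_mul_le (by omega)).2 (not_lt.1 hshort))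
  have hBN : N₀ / (n + 1) * (n + 1) ≤ N₀ := Nat.div_mul_le_self _ _
  obtain ⟨j, hj, hjle⟩ := hf.exists_empMSE_le hP (n := n) hB (hBN.trans hL)
    (fun b hb k => by
      obtain ⟨t, h1, h2, h3⟩ := hcov b hb k
      exact ⟨t, h1, by omega, h3⟩)
    (C := √(3 / 2) * |MX|) (by positivity)
    (fun k => by
      refine le_of_sq_le_sq ?_ (by positivity)
      rw [mul_pow, sq_abs, Real.sq_sqrt (by norm_num)]
      exact (norm_predVec_feature_sq_le hz.cov k).trans (by gcongr; exact hMX k)) hβ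
  have hloss := hN.block_loss_le hη (not_lt.1 hshort) (not_lt.1 hbig)
    (by rw [empMSE_eq_norm]; positivity)
  exact ⟨j, hj.trans hBN, fun k hk => by
    linarith [hgap (P k), hf.empMSE_path_antitone hP hk, hz.benchmark]⟩

/-- The bounds on the data are nonnegative, and they bound the smallest eigenvalue. -/
theorem IsBoundedLaw.bounds {d : ℕ} (hd : 2 ≤ d) {D : Measure ((Fin d → ℝ) × ℝ)} {X Y R : ℝ}
    (hD : IsBoundedLaw D X Y R) (hlam : 0 < lambdaMin D) :
    0 ≤ X ∧ 0 ≤ Y ∧ 0 < R ∧ lambdaMin D ≤ X ^ 2 := by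
  have := hD.prob
  obtain ⟨q, hq⟩ := hD.ae_mem.exists
  set k : Fin d := ⟨0, by omega⟩
  have h1 := lambdaMin_le_diag D k
  have h2 : ∀ q ∈ box d X Y R, |q.1 k ^ 2| ≤ R := fun q hq => by
    rw [abs_of_nonneg (sq_nonneg _)]
    exact (Finset.single_le_sum (f := fun k => q.1 k ^ 2) (fun _ _ => sq_nonneg _)
      (Finset.mem_univ k)).trans hq.2.2
  have h3 := (le_abs_self _).trans (abs_integral_le_of_abs_le_on hD.ae_mem h2)
  have h4 : ∀ q ∈ box d X Y R, |q.1 k ^ 2| ≤ X ^ 2 := fun q hq => by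
    have := abs_mul_le_of_mem_box hq k k
    rwa [← sq] at this
  have h5 := (le_abs_self _).trans (abs_integral_le_of_abs_le_on hD.ae_mem h4)
  exact ⟨(abs_nonneg _).trans (hq.1 k), (abs_nonneg _).trans hq.2.1, by linarith, by linarith⟩

/-- A union bound, so coverage and data may be dependent. -/
theorem one_sub_add_le_measureReal_inter {Ω : Type*} [MeasurableSpace Ω] {μ : Measure Ω}
    [IsProbabilityMeasure μ] {E F : Set Ω} (hF : MeasurableSet F) {a b : ℝ}
    (ha : 1 - a ≤ μ.real E) (hb : 1 - b ≤ μ.real F) : 1 - (a + b) ≤ μ.real (E ∩ F) := by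
  have h1 := measureReal_union_add_inter (μ := μ) (s := E) hF
  have h2 : μ.real (E ∪ F) ≤ 1 := measureReal_le_one
  linarith

theorem IsIIDSample.map_eq_pi {Ω : Type*} [MeasurableSpace Ω] {μ : Measure Ω}
    [IsProbabilityMeasure μ] {d m : ℕ}
    {Z : Fin m → Ω → (Fin d → ℝ) × ℝ} {D : Measure ((Fin d → ℝ) × ℝ)}
    (hZ : IsIIDSample μ Z D) : μ.map (fun ω j => Z j ω) = Measure.pi fun _ => D := by
  rw [(iIndepFun_iff_map_fun_eq_pi_map fun j => (hZ.measurable j).aemeasurable).1 hZ.indep]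
  simp_rw [hZ.law]

end DagLearning

/-! ### The performance guarantee -/

theorem mainTheorem10
    (δL : ℝ) (hδL : δL ∈ Set.Ioo (0 : ℝ) 1) (W : ℝ) :
    -- the constant in the rate for the path length
    ∃ K : ℝ, 0 < K ∧
      ∀ (d : ℕ) (_ : 2 ≤ d)
        (D : Measure ((Fin d → ℝ) × ℝ)) (_ : IsProbabilityMeasure D)
        (X Y RX MX : ℝ)
        (_ : ∀ᵐ z ∂D, ∀ k, |z.1 k| ≤ X)
        (_ : ∀ᵐ z ∂D, |z.2| ≤ Y)
        (_ : ∀ᵐ z ∂D, ∑ k, z.1 k ^ 2 ≤ RX ^ 2)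
        (_ : ∀ k, ∫ z, z.1 k ^ 2 ∂D ≤ MX ^ 2)
        (_ : 0 < DagLearning.lambdaMin D)
        (A : ℝ) (βopt : Fin d → ℝ) (_ : DagLearning.IsOptimalLinear D A βopt)
        (_ : DagLearning.mse D (fun _ => 0) * (A * MX) ^ 2 ≤ W)
        (p : ℝ) (_ : p ∈ Set.Ioo (0 : ℝ) 1)
        (η : ℝ) (_ : 0 < η),
        -- an admissible path length exists, with the stated rate
        (∃ N₀ M : ℕ,
          DagLearning.IsRequiredLength d p δL η (DagLearning.mse D (fun _ => 0)) A MX N₀ M ∧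
          (η ≤ 1 →
            (N₀ : ℝ) ≤ K * ((Real.log d + Real.log (1 / (p * η))) ^ 2 / (p ^ 2 * η ^ 2)))) ∧
        ∀ (δm : ℝ) (_ : δm ∈ Set.Ioo (0 : ℝ) 1)
          (m : ℕ)
          (_ : 4 * 4 ^ 2 * RX ^ 4 * (Real.log d + Real.log (1 / δm))
              / DagLearning.lambdaMin D ^ 2 < m),
          -- the order of the generalization error
          DagLearning.epsGen d m X Y (DagLearning.lambdaMin D) δm ≤
            16 * (DagLearning.coeffBound d Y (DagLearning.lambdaMin D) * X + Y)
              * √(1 + Real.log (1 / δm))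
              * (√d * X * Y / √(DagLearning.lambdaMin D) * √(Real.log d / m)) ∧
          -- the performance guarantee, for every admissible path length
          ∀ (N₀ M : ℕ)
            (_ : DagLearning.IsRequiredLength d p δL η
              (DagLearning.mse D (fun _ => 0)) A MX N₀ M)
            (V : Type*) (_ : Fintype V) (G : Digraph V) (_ : DagLearning.IsDAG G)
            (L : ℕ) (_ : N₀ ≤ L) (P : Fin L → V) (_ : DagLearning.IsPath G P)
            (Ω : Type*) (_ : MeasurableSpace Ω) (μ : Measure Ω) (_ : IsProbabilityMeasure μ)
            (S : V → Ω → Set (Fin d)) (_ : DagLearning.IsRandomAllocation μ S p)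
            (Z : Fin m → Ω → (Fin d → ℝ) × ℝ) (_ : DagLearning.IsIIDSample μ Z D),
            ∃ E : Set Ω, MeasurableSet E ∧ 1 - δL - 2 * δm ≤ μ.real E ∧
              ∀ ω ∈ E, ∀ f : V → (Fin d → ℝ) → ℝ,
                DagLearning.IsLeastSquaresFit (DagLearning.empMSE fun j => Z j ω) G
                  (fun i => S i ω) f →
                ∃ j : Fin L, (j : ℕ) + 1 ≤ N₀ ∧ ∀ k : Fin L, j ≤ k →
                  DagLearning.mse D (f (P k)) ≤ DagLearning.mse D (DagLearning.linPred βopt) + η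
                    + 2 * DagLearning.epsGen d m X Y (DagLearning.lambdaMin D) δm := by
  obtain ⟨K, hK, hlen⟩ := DagLearning.exists_isRequiredLength hδL W
  refine ⟨K, hK, fun d hd D hprob X Y RX MX hXD hYD hRD hMX hlam A βopt hβ hW p hp η hη =>
    ⟨hlen d hd _ A MX hW p hp η hη, fun δm hδm m hm => ?_⟩⟩
  have hD : DagLearning.IsBoundedLaw D X Y (RX ^ 2) := ⟨hprob, by
    filter_upwards [hXD, hYD, hRD] with q h1 h2 h3 using ⟨h1, h2, h3⟩⟩
  obtain ⟨hX, hY, hR, hlamX⟩ := hD.bounds hd hlam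
  refine ⟨DagLearning.epsGen_le hd hlam hX hY hlamX hδm, ?_⟩
  intro N₀ M hN V _ G hG L hL P hP Ω _ μ _ S hS Z hZ
  have hm0 : 0 < m := by
    have hl : 0 < Real.log (1 / δm) :=
      Real.log_pos (by rw [lt_div_iff₀ hδm.1]; linarith [hδm.2])
    have hld := DagLearning.half_le_log hd
    have : (0 : ℝ) < m := lt_of_le_of_lt (by positivity) hm
    exact_mod_cast this
  set n := M - 1
  have hM : M = n + 1 := by have := hN.one_le_block; omega
  have hBL : N₀ / M * (n + 1) ≤ L := by
    rw [← hM]; exact (Nat.div_mul_le_self _ _).trans hL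
  obtain ⟨E₁, hE₁, hμ₁, hcov⟩ := hS.exists_coverage (DagLearning.path_injective hG hP) hBL
  have hunion := hN.blocks_mul_le hd hp hδL
  rw [← hM] at hμ₁
  have hgood := hD.le_measureReal_isGoodSample hd hX hY hR hlam hβ hδm hm
  have hgm := hD.measurableSet_isGoodSample (m := m)
    (DagLearning.coeffBound d Y (DagLearning.lambdaMin D))
    (DagLearning.epsGen d m X Y (DagLearning.lambdaMin D) δm)
    (Y ^ 2 * √(Real.log (2 / δm) / (2 * m))) βopt
  have hZm : Measurable fun ω j => Z j ω := measurable_pi_lambda _ hZ.measurable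
  rw [← hZ.map_eq_pi, map_measureReal_apply hZm hgm] at hgood
  have hE₂ := hZm hgm
  -- The event is fixed before the fit `f`, so the guarantee covers every way of breaking ties.
  refine ⟨E₁ ∩ _, hE₁.inter hE₂, ?_, ?_⟩
  · have := DagLearning.one_sub_add_le_measureReal_inter hE₂ hμ₁ hgood
    linarith
  · rintro ω ⟨hω₁, hω₂⟩ f hf
    have hω₂' : DagLearning.IsGoodSample D X Y (RX ^ 2) _ _ _ βopt fun j => Z j ω := hω₂
    refine hω₂'.exists_forall_mse_le hD hm0 hY hlam ?_ (by positivity) hβ.1 hMX hη hN hG hL hP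
      (fun b hb k => ?_) hf
    -- `4 * t ≤ ε` holds because `4 * Y ^ 2 = (2 * Y) ^ 2` and `2 * Y ≤ Λ * X`.
    · have h2 := DagLearning.two_mul_le_coeffBound_mul hd hlam hX hY hlamX
      have hΛ := DagLearning.coeffBound_nonneg d (lam := DagLearning.lambdaMin D) hY
      unfold DagLearning.epsGen
      set Λ := DagLearning.coeffBound d Y (DagLearning.lambdaMin D)
      have h3 : (2 * Y) ^ 2 * √(Real.log (2 / δm) / (2 * m))
          ≤ (Λ * X + Y) ^ 2 * √(Real.log (2 / δm) / (2 * m)) := by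
        gcongr
        linarith
      have h4 : 0 ≤ 8 * (Λ * X + Y) * (Λ * X) * √(Real.log d / m) := by positivity
      linarith
    · obtain ⟨t, h1, h2, h3⟩ := hcov ω hω₁ b hb k
      rw [hM]
      exact ⟨t, h1, by omega, h3⟩
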